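/- Let $q$ be a prime power and let $\mathbb{F}_q$ be a finite field with $q$ elements. An $n$-arc in the projective space $\mathbb{P}^{k-1}(\mathbb{F}_q)$ is a set of $n$ points such that no $k$ of them lie on a hyperplane. Let $C_{n,k}(q)$ denote the number of ordered $n$-arcs in $\mathbb{P}^{k-1}(\mathbb{F}_q)$, that is, of $n$-tuples of distinct points whose underlying set is an $n$-arc. Let $a(q)=1$ if $2\mid q$ and $a(q)=0$ if $2\nmid q$. Then $$C_{4,4}(q) = (q^2+q+1)(q^2+1)(q+1)^2q^6,$$ $$C_{5,4}(q) = (q^2+q+1)(q^2+1)(q+1)^2(q-1)^3q^6,$$ $$C_{6,4}(q) = (q^2+q+1)(q^2+1)(q+1)^2(q-1)^3(q-2)(q-3)(q-4)q^6,$$ $$C_{7,4}(q) = (q^2+q+1)(q^2+1)(q+1)^2(q-1)^3q^6\left(q^6-28q^5+323q^4-1952q^3+6462q^2-11004q+7470-30a(q)\right).$$ -/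

import Mathlib

open scoped LinearAlgebra.Projectivization

/-- A set `S` of points of the projective space `ℙ F (Fin k → F)`, of dimension `k - 1`, such that
no `k` distinct points of `S` lie on a common hyperplane. A hyperplane is given by a linear subspace
`H` of `F ^ k` of dimension `k - 1`, and a point lies on it if the corresponding line through the
origin is contained in `H`. -/
def IsProjectiveArc (F : Type*) [Field F] (k : ℕ) (S : Set (ℙ F (Fin k → F))) : Prop :=
  ∀ T : Finset (ℙ F (Fin k → F)), (T : Set (ℙ F (Fin k → F))) ⊆ S → T.card = k →
    ∀ H : Submodule F (Fin k → F), Module.finrank F H + 1 = k → ¬ ∀ P ∈ T, P.submodule ≤ H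

/-- Ordered `n`-arcs in the projective space of dimension `k - 1` over `F`: tuples of `n` distinct
points whose underlying set is an arc. -/
def OrderedArc (F : Type*) [Field F] (n k : ℕ) : Type _ :=
  {p : Fin n → ℙ F (Fin k → F) // Function.Injective p ∧ IsProjectiveArc F k (Set.range p)}

/-- The number `C_{n,k}` of ordered `n`-arcs in the projective space of dimension `k - 1` over `F`
(meaningful for a finite field `F`). -/
noncomputable def numOrderedArcs (F : Type*) [Field F] (n k : ℕ) : ℕ :=
  Nat.card (OrderedArc F n k)

/-- The function `a(q)`, equal to `1` for even `q` and to `0` for odd `q`. -/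
def evenIndicator (q : ℕ) : ℤ := if 2 ∣ q then 1 else 0

/-! Replacing each point by its nonzero representatives turns ordered arcs into tuples of vectors of
which every `k` are independent, at the cost of a factor `(q - 1) ^ n` (`numOrderedArcs_mul`). Read
as the columns of a `k × n` matrix, such a tuple is an MDS code of dimension `k` in `F ^ n` together
with an ordered basis. Orthogonal complement exchanges the MDS codes of dimensions `k` and `n - k`,
so arcs of `n` points for `k = 4` are counted by tuples in `F ^ (n - 4)` (`card_genPos_dual`), that
is, in dimension 0, 1, 2 or 3.

Dimensions 0 and 1 are immediate. In dimension 2 a new vector only has to avoid the lines already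
present. In dimension 3 it has to avoid the planes spanned by pairs. Off the given vectors, planes
sharing an index do not meet, so inclusion and exclusion runs over sets of disjoint pairs, of which
there are at most three members when `n ≤ 6` (`GenPos.card_isOffPlanes`). One plane contributes `(q
- 1) ^ 2` vectors, and two disjoint ones contribute `q - 1`.

The triple term occurs only for six vectors, and there it depends on the sextuple. It is therefore
summed over all sextuples: the 15 perfect matchings contribute equally, four of the vectors can be
moved to a standard frame, and the remaining pairs with a concurrent line are parametrised by three
field elements (`card_isConcurrenceParam`). The term `30 * a(q)` is 15 times the correction `2 *
a(q)` found there, which comes from `-1 = 1` in characteristic two. -/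

/-- A family of `n` vectors of `F ^ k` such that every `k` of them are linearly independent. -/
def GenPos (F : Type*) [Field F] {n k : ℕ} (p : Fin n → Fin k → F) : Prop :=
  ∀ e : Fin k → Fin n, e.Injective → LinearIndependent F (p ∘ e)

/-! ### From arcs of points to tuples of vectors in general position. -/

section GeneralPosition

variable {F : Type*} [Field F] {n k : ℕ}

theorem GenPos.linearIndepOn {p : Fin n → Fin k → F} (hp : GenPos F p) (hkn : k ≤ n)
    (s : Finset (Fin n)) (hs : s.card ≤ k) : LinearIndepOn F p (s : Set (Fin n)) := by
  obtain ⟨t, hst, ht⟩ := Finset.exists_superset_card_eq hs (by simpa using hkn)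
  have h := (linearIndepOn_range_iff (t.orderEmbOfFin ht).injective p).2
    (hp _ (t.orderEmbOfFin ht).injective)
  refine h.mono ?_
  rw [Finset.range_orderEmbOfFin]
  exact_mod_cast hst

theorem GenPos.ne_zero {p : Fin n → Fin k → F} (hp : GenPos F p) (hkn : k ≤ n) (hk : 1 ≤ k)
    (i : Fin n) : p i ≠ 0 :=
  (hp.linearIndepOn hkn {i} (by simpa using hk)).ne_zero (by simp)

theorem genPos_units_smul (p : Fin n → Fin k → F) (c : Fin n → Fˣ) :
    GenPos F (fun i => c i • p i) ↔ GenPos F p :=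
  forall_congr' fun e => forall_congr' fun _ =>
    LinearIndependent.units_smul_iff (p ∘ e) (c ∘ e)

/-- Dependent `k`-tuples span a proper subspace, hence lie in the kernel of a nonzero functional,
which is a hyperplane; independent ones do not fit into dimension `k - 1`. -/
theorem isProjectiveArc_range_iff {p : Fin n → ℙ F (Fin k → F)} (hp : p.Injective) :
    IsProjectiveArc F k (Set.range p) ↔ GenPos F (fun i => (p i).rep) := by
  classical
  constructor
  · intro h e he
    by_contra hli
    have hlt : Submodule.span F (Set.range ((fun i => (p i).rep) ∘ e)) < ⊤ := by
      refine lt_top_iff_ne_top.2 fun htop => hli ?_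
      exact linearIndependent_of_top_le_span_of_card_eq_finrank htop.ge (by simp)
    obtain ⟨f, hf, hle⟩ := Submodule.exists_le_ker_of_lt_top _ hlt
    refine h (Finset.univ.image (p ∘ e)) (by
      rw [Finset.coe_image, Finset.coe_univ, Set.image_univ]
      exact Set.range_comp_subset_range e p) ?_
      (LinearMap.ker f) (by simpa using Module.Dual.finrank_ker_add_one_of_ne_zero hf) ?_
    · rw [Finset.card_image_of_injective _ (hp.comp he), Finset.card_univ, Fintype.card_fin]
    · intro P hP
      obtain ⟨i, -, rfl⟩ := Finset.mem_image.1 hP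
      rw [Projectivization.submodule_eq, Submodule.span_singleton_le_iff_mem]
      exact hle (Submodule.subset_span ⟨i, rfl⟩)
  · intro h T hT hcard H hH hle
    have hex : ∀ P : T, ∃ i, p i = P := fun P => hT P.2
    choose g hg using hex
    let e : Fin k → Fin n := fun j => g (T.equivFinOfCardEq hcard |>.symm j)
    have he : e.Injective := fun a b hab => by
      have := congrArg p hab
      simp only [e, hg] at this
      exact (T.equivFinOfCardEq hcard).symm.injective (Subtype.ext this)
    have hmem : ∀ j, (p (e j)).rep ∈ H := fun j => by
      have := hle (p (e j)) (by simp only [e, hg]; exact Subtype.property _)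
      rwa [Projectivization.submodule_eq, Submodule.span_singleton_le_iff_mem] at this
    have hli : LinearIndependent F (fun j => (⟨(p (e j)).rep, hmem j⟩ : H)) :=
      LinearIndependent.of_comp H.subtype (h e he)
    have := hli.fintype_card_le_finrank
    rw [Fintype.card_fin] at this
    omega

/-- Scaling representatives: the tuples of vectors in general position are the ordered arcs
together with a nonzero scalar for every point. -/
theorem numOrderedArcs_mul [Finite F] (hk : 2 ≤ k) (hkn : k ≤ n) :
    numOrderedArcs F n k * (Nat.card F - 1) ^ n =
      Nat.card {p : Fin n → Fin k → F // GenPos F p} := by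
  have hu : (Nat.card F - 1) ^ n = Nat.card (Fin n → Fˣ) := by
    rw [Nat.card_fun, Nat.card_units, Nat.card_fin]
  rw [hu, numOrderedArcs, ← Nat.card_prod]
  refine Nat.card_eq_of_bijective (fun x => ⟨fun i => x.2 i • (x.1.1 i).rep,
    (genPos_units_smul _ _).2 ((isProjectiveArc_range_iff x.1.2.1).1 x.1.2.2)⟩) ⟨?_, ?_⟩
  · rintro ⟨⟨P, hP⟩, c⟩ ⟨⟨Q, hQ⟩, d⟩ h
    have h' : ∀ i, c i • (P i).rep = d i • (Q i).rep := fun i => congrFun (congrArg Subtype.val h) i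
    have hPQ : P = Q := by
      funext i
      rw [← (P i).mk_rep, ← (Q i).mk_rep, Projectivization.mk_eq_mk_iff]
      exact ⟨(c i)⁻¹ * d i, by rw [mul_smul, ← h' i, inv_smul_smul]⟩
    subst hPQ
    have hcd : c = d := by
      funext i
      have := h' i
      rw [Units.smul_def, Units.smul_def] at this
      exact Units.ext (smul_left_injective F (P i).rep_nonzero this)
    rw [hcd]
  · rintro ⟨v, hv⟩
    have hne := hv.ne_zero hkn (by omega)
    choose c hc using fun i => Projectivization.exists_smul_eq_mk_rep F (v i) (hne i)
    let P : Fin n → ℙ F (Fin k → F) := fun i => Projectivization.mk F (v i) (hne i)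
    -- Two vectors on the same line are a dependent pair, which general position excludes because `2
    -- ≤ k`.
    have hP : P.Injective := by
      intro i j hij
      by_contra hne'
      obtain ⟨a, ha⟩ := (Projectivization.mk_eq_mk_iff' F _ _ (hne i) (hne j)).1 hij
      have hli := hv.linearIndepOn hkn {i, j} (Finset.card_le_two.trans hk)
      rw [Finset.coe_pair, LinearIndepOn.pair_iff _ hne'] at hli
      exact one_ne_zero (hli 1 (-a) (by rw [← ha]; module)).1
    refine ⟨⟨⟨P, hP, (isProjectiveArc_range_iff hP).2 ?_⟩, fun i => (c i)⁻¹⟩, ?_⟩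
    · have : (fun i => (P i).rep) = fun i => c i • v i := funext fun i => (hc i).symm
      rw [this]
      exact (genPos_units_smul _ _).2 hv
    · refine Subtype.ext (funext fun i => ?_)
      simp only [P, ← hc i, inv_smul_smul]

end GeneralPosition

/-! ### MDS codes and duality between dimensions `k` and `n - k`. -/

section Duality

variable {F : Type*} [Field F] {n : ℕ}

/-- A `k`-dimensional subspace of `F ^ n` on which every `k` coordinates are independent. -/
def IsMDS (k : ℕ) (W : Submodule F (Fin n → F)) : Prop :=
  Module.finrank F W = k ∧
    ∀ e : Fin k → Fin n, e.Injective → ∀ w ∈ W, (∀ j, w (e j) = 0) → w = 0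

theorem linearIndependent_transpose_iff {k : ℕ} (A : Fin k → Fin k → F) :
    LinearIndependent F A ↔ LinearIndependent F (fun i j => A j i) := by
  have h1 : LinearIndependent F A ↔ IsUnit (Matrix.of A) :=
    Matrix.linearIndependent_rows_iff_isUnit (A := Matrix.of A)
  have h2 : LinearIndependent F (fun i j => A j i) ↔ IsUnit (Matrix.of A) :=
    Matrix.linearIndependent_cols_iff_isUnit (A := Matrix.of A)
  rw [h1, h2]

/-- A square matrix has independent rows exactly when it has independent columns. Hence on any `k`
coordinates the `k` rows stay independent, and a combination of them vanishing there has only zero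
coefficients. -/
theorem GenPos.isMDS_span {k : ℕ} (hkn : k ≤ n) {p : Fin n → Fin k → F} (hp : GenPos F p) :
    LinearIndependent F (fun i j => p j i) ∧
      IsMDS k (Submodule.span F (Set.range fun i j => p j i)) := by
  have hrow : ∀ e : Fin k → Fin n, e.Injective →
      LinearIndependent F (fun i j => p (e j) i) := fun e he =>
    (linearIndependent_transpose_iff _).1 (hp e he)
  have hli : LinearIndependent F (fun i j => p j i) :=
    LinearIndependent.of_comp (LinearMap.funLeft F F (Fin.castLE hkn))
      (hrow _ (Fin.castLE_injective hkn))
  refine ⟨hli, by simpa using finrank_span_eq_card hli, fun e he w hw h0 => ?_⟩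
  obtain ⟨c, rfl⟩ := (Submodule.mem_span_range_iff_exists_fun F).1 hw
  have hc := Fintype.linearIndependent_iff.1 (hrow e he) c (by
    funext j
    simpa using h0 j)
  simp [hc]

theorem IsMDS.genPos {k : ℕ} {W : Submodule F (Fin n → F)} (hW : IsMDS k W) {r : Fin k → W}
    (hr : LinearIndependent F r) : GenPos F (fun j i => (r i : Fin n → F) j) := by
  intro e he
  rw [linearIndependent_transpose_iff, Fintype.linearIndependent_iff]
  intro c hc
  refine Fintype.linearIndependent_iff.1 hr c (Subtype.ext ?_)
  refine hW.2 e he _ (Subtype.property _) fun j => ?_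
  simpa using congrFun hc j

/-- A tuple in general position is the same as an MDS code, the row space, with an ordered basis,
the rows. The number of ordered bases is the same for every code. -/
theorem card_genPos_eq_mul [Finite F] {k : ℕ} (hkn : k ≤ n) :
    Nat.card {p : Fin n → Fin k → F // GenPos F p} =
      Nat.card {W : Submodule F (Fin n → F) // IsMDS k W} *
        ∏ i : Fin k, (Nat.card F ^ k - Nat.card F ^ (i : ℕ)) := by
  classical
  have := Fintype.ofFinite F
  have := Fintype.ofFinite {W : Submodule F (Fin n → F) // IsMDS k W}
  have hb : ∀ W : {W : Submodule F (Fin n → F) // IsMDS k W},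
      Nat.card {r : Fin k → W.1 // LinearIndependent F r} =
        ∏ i : Fin k, (Nat.card F ^ k - Nat.card F ^ (i : ℕ)) := by
    rintro ⟨W, hW⟩
    have := card_linearIndependent (K := F) (V := W) (k := k) hW.1.ge
    rwa [hW.1, ← Nat.card_eq_fintype_card] at this
  have hs : Nat.card (Σ W : {W : Submodule F (Fin n → F) // IsMDS k W},
      {r : Fin k → W.1 // LinearIndependent F r}) =
      Nat.card {W : Submodule F (Fin n → F) // IsMDS k W} *
        ∏ i : Fin k, (Nat.card F ^ k - Nat.card F ^ (i : ℕ)) := by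
    rw [Nat.card_sigma, Finset.sum_congr rfl fun W _ => hb W]
    simp
  rw [← hs]
  refine (Nat.card_eq_of_bijective (fun x => ⟨_, x.1.2.genPos x.2.2⟩) ⟨?_, ?_⟩).symm
  · rintro ⟨⟨W, hW⟩, r, hr⟩ ⟨⟨W', hW'⟩, r', hr'⟩ h
    have hrr : ∀ i, (r i : Fin n → F) = r' i := fun i => funext fun j =>
      congrFun (congrFun (congrArg Subtype.val h) j) i
    have hspan : ∀ {U : Submodule F (Fin n → F)} (_ : IsMDS k U) {s : Fin k → U}
        (_ : LinearIndependent F s),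
        Submodule.span F (Set.range fun i => (s i : Fin n → F)) = U := by
      intro U hU s hs
      refine Submodule.eq_of_le_of_finrank_eq ?_ ?_
      · rw [Submodule.span_le]
        rintro _ ⟨i, rfl⟩
        exact (s i).2
      · have := finrank_span_eq_card (hs.map' U.subtype U.ker_subtype)
        rw [hU.1]
        rw [Fintype.card_fin] at this
        exact this
    have hWW : W = W' := by rw [← hspan hW hr, ← hspan hW' hr']; simp only [hrr]
    subst hWW
    have : r = r' := funext fun i => Subtype.ext (hrr i)
    subst this
    rfl
  · rintro ⟨p, hp⟩
    obtain ⟨hli, hM⟩ := hp.isMDS_span hkn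
    exact ⟨⟨⟨_, hM⟩, _, linearIndependent_span hli⟩, Subtype.ext rfl⟩

/-- The standard dot product as a bilinear form. -/
abbrev dotForm (F : Type*) [Field F] (n : ℕ) : LinearMap.BilinForm F (Fin n → F) :=
  dotProductBilin F F

theorem dotForm_isRefl : (dotForm F n).IsRefl := fun x y h => by
  simpa [dotForm, dotProductBilin, dotProduct_comm] using h

theorem dotForm_nondegenerate : (dotForm F n).Nondegenerate := by
  have h : (dotForm F n).SeparatingLeft := fun x hx => dotProduct_eq_zero x hx
  exact ⟨h, fun x hx => h x fun y => dotForm_isRefl _ _ (hx y)⟩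

/-- If `w` is orthogonal to `W` and vanishes on `l` coordinates, only the complementary `k`
coordinates matter. `W` projects onto these isomorphically, so it has elements restricting to each
unit vector there, and the dot product with them reads off the remaining entries of `w`. -/
theorem IsMDS.orthogonal {k l : ℕ} (hkl : k + l = n) {W : Submodule F (Fin n → F)}
    (hW : IsMDS k W) : IsMDS l ((dotForm F n).orthogonal W) := by
  classical
  refine ⟨?_, fun e he w hw h0 => ?_⟩
  · rw [LinearMap.BilinForm.finrank_orthogonal dotForm_nondegenerate, hW.1]
    simp only [Module.finrank_fintype_fun_eq_card, Fintype.card_fin]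
    omega
  · have hcard : ((Finset.univ.image e)ᶜ).card = k := by
      rw [Finset.card_compl, Finset.card_image_of_injective _ he]
      simp only [Fintype.card_fin, Finset.card_univ]
      omega
    let g := ((Finset.univ.image e)ᶜ).orderEmbOfFin hcard
    have hg : ∀ j, (∃ i, e i = j) ∨ ∃ i, g i = j := by
      intro j
      by_cases hj : ∃ i, e i = j
      · exact Or.inl hj
      · right
        have : j ∈ Set.range g := by
          simp only [g]
          rw [Finset.range_orderEmbOfFin]
          simpa using hj
        exact this
    let φ : W →ₗ[F] (Fin k → F) := (LinearMap.funLeft F F g).comp W.subtype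
    have hφ : Function.Injective φ := by
      rw [← LinearMap.ker_eq_bot, LinearMap.ker_eq_bot']
      intro x hx
      exact Subtype.ext (hW.2 g g.injective x x.2 fun j => congrFun hx j)
    have hsurj : Function.Surjective φ :=
      (LinearMap.injective_iff_surjective_of_finrank_eq_finrank (by simpa using hW.1)).1 hφ
    funext j
    rcases hg j with ⟨i, rfl⟩ | ⟨i, rfl⟩
    · exact h0 i
    · obtain ⟨x, hx⟩ := hsurj (Pi.single i 1)
      have hdot : ∑ j, (x : Fin n → F) j * w j = 0 := hw x x.2
      rw [Finset.sum_eq_single (g i)] at hdot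
      · have : (x : Fin n → F) (g i) = 1 :=
        (congrFun hx i).trans (Pi.single_eq_same i 1)
        simpa [this] using hdot
      · intro b _ hb
        rcases hg b with ⟨i', rfl⟩ | ⟨i', rfl⟩
        · rw [h0, mul_zero]
        · have : (x : Fin n → F) (g i') = 0 := by
            have := congrFun hx i'
            rw [Pi.single_eq_of_ne (fun h => hb (by rw [h]))] at this
            exact this
          rw [this, zero_mul]
      · simp

theorem card_isMDS_dual {k l : ℕ} (hkl : k + l = n) :
    Nat.card {W : Submodule F (Fin n → F) // IsMDS k W} =
      Nat.card {W : Submodule F (Fin n → F) // IsMDS l W} :=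
  Nat.card_congr
    { toFun := fun W => ⟨(dotForm F n).orthogonal W.1, W.2.orthogonal hkl⟩
      invFun := fun W => ⟨(dotForm F n).orthogonal W.1, W.2.orthogonal ((add_comm l k).trans hkl)⟩
      left_inv := fun _ => Subtype.ext
        (LinearMap.BilinForm.orthogonal_orthogonal dotForm_nondegenerate dotForm_isRefl _)
      right_inv := fun _ => Subtype.ext
        (LinearMap.BilinForm.orthogonal_orthogonal dotForm_nondegenerate dotForm_isRefl _) }

/-- Gale duality for the number of tuples of vectors in general position. -/
theorem card_genPos_dual [Finite F] {k l : ℕ} (hkl : k + l = n) :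
    Nat.card {p : Fin n → Fin k → F // GenPos F p} *
        ∏ i : Fin l, (Nat.card F ^ l - Nat.card F ^ (i : ℕ)) =
      Nat.card {p : Fin n → Fin l → F // GenPos F p} *
        ∏ i : Fin k, (Nat.card F ^ k - Nat.card F ^ (i : ℕ)) := by
  rw [card_genPos_eq_mul (by omega : k ≤ n), card_genPos_eq_mul (by omega : l ≤ n),
    card_isMDS_dual hkl, mul_right_comm]

theorem card_genPos_self [Finite F] (k : ℕ) :
    Nat.card {p : Fin k → Fin k → F // GenPos F p} =
      ∏ i : Fin k, (Nat.card F ^ k - Nat.card F ^ (i : ℕ)) := by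
  have := Fintype.ofFinite F
  have h := card_linearIndependent (K := F) (V := Fin k → F) (k := k) (by simp)
  rw [Module.finrank_fintype_fun_eq_card, Fintype.card_fin, ← Nat.card_eq_fintype_card] at h
  rw [← h]
  refine Nat.card_congr (Equiv.subtypeEquivRight fun p =>
    ⟨fun hp => ?_, fun hp e he => hp.comp e he⟩)
  exact hp id Function.injective_id

theorem card_genPos_zero : Nat.card {p : Fin n → Fin 0 → F // GenPos F p} = 1 := by
  have : Unique {p : Fin n → Fin 0 → F // GenPos F p} :=
    { default := ⟨fun _ => 0, fun _ _ => linearIndependent_empty_type⟩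
      uniq := fun _ => Subtype.ext (Subsingleton.elim _ _) }
  exact Nat.card_unique

theorem card_genPos_one [Finite F] :
    Nat.card {p : Fin n → Fin 1 → F // GenPos F p} = (Nat.card F - 1) ^ n := by
  have hu : (Nat.card F - 1) ^ n = Nat.card (Fin n → Fˣ) := by
    rw [Nat.card_fun, Nat.card_units, Nat.card_fin]
  have hc : ∀ c : Fin n → Fˣ, GenPos F (fun i (_ : Fin 1) => (c i : F)) := fun c e _ => by
    rw [linearIndependent_unique_iff]
    exact fun h => (c (e default)).ne_zero (congrFun h 0)
  rw [hu]
  refine (Nat.card_eq_of_bijective (fun c => ⟨fun i _ => (c i : F), hc c⟩) ⟨?_, ?_⟩).symm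
  · intro c d h
    exact funext fun i => Units.ext (congrFun (congrFun (congrArg Subtype.val h) i) 0)
  · rintro ⟨p, hp⟩
    have hne : ∀ i, p i 0 ≠ 0 := fun i h => by
      have := (hp (fun _ => i) (Function.injective_of_subsingleton _)).ne_zero 0
      exact this (funext fun j => by rw [Subsingleton.elim j 0]; exact h)
    refine ⟨fun i => Units.mk0 _ (hne i), Subtype.ext (funext fun i => funext fun j => ?_)⟩
    rw [Subsingleton.elim j 0]
    rfl

end Duality

/-! ### Extending a tuple by one vector, and the count in dimension two. -/

section Extension

variable {F : Type*} [Field F] {n k : ℕ}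

/-- The vectors that are not a multiple of a member of the family `p`. -/
def IsOffPoints (p : Fin n → Fin k → F) (v : Fin k → F) : Prop :=
  ∀ i, ∀ c : F, v ≠ c • p i

/-- The lines through the `p i` meet pairwise only in zero, so their union has `n * (q - 1) + 1`
elements. -/
theorem card_isOffPoints [Fintype F] (hn : 0 < n) {p : Fin n → Fin k → F}
    (hne : ∀ i, p i ≠ 0) (hpair : ∀ i j, i ≠ j → ∀ c : F, p i ≠ c • p j) :
    (Nat.card {v // IsOffPoints p v} : ℤ) =
      (Fintype.card F : ℤ) ^ k - 1 - n * ((Fintype.card F : ℤ) - 1) := by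
  classical
  have hq : 1 ≤ Fintype.card F := Fintype.card_pos
  have hbad : Nat.card {v // ¬ IsOffPoints p v} = n * (Fintype.card F - 1) + 1 := by
    -- `none` stands for the zero vector, `some (i, c)` for `c • p i`.
    have : n * (Fintype.card F - 1) + 1 = Nat.card (Option (Fin n × Fˣ)) := by
      simp [Nat.card_eq_fintype_card, Fintype.card_units]
    rw [this]
    refine (Nat.card_eq_of_bijective (fun x : Option (Fin n × Fˣ) =>
      (⟨x.elim 0 fun y => (y.2 : F) • p y.1, ?_⟩ : {v // ¬ IsOffPoints p v})) ⟨?_, ?_⟩).symm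
    · intro h
      cases x with
      | none => exact h ⟨0, hn⟩ 0 (by simp)
      | some y => exact h y.1 y.2 rfl
    · intro x y h
      have h := congrArg Subtype.val h
      rcases x with _ | ⟨i, c⟩ <;> rcases y with _ | ⟨j, d⟩
      · rfl
      · exact absurd h.symm (smul_ne_zero d.ne_zero (hne j))
      · exact absurd h (smul_ne_zero c.ne_zero (hne i))
      · have h : (c : F) • p i = (d : F) • p j := h
        have hij : i = j := by
          by_contra hij
          refine hpair i j hij ((c : F)⁻¹ * d) ?_
          rw [mul_smul, ← h, inv_smul_smul₀ c.ne_zero]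
        subst hij
        rw [Units.ext (smul_left_injective F (hne i) h)]
    · rintro ⟨v, hv⟩
      simp only [IsOffPoints, not_forall, not_not] at hv
      obtain ⟨i, c, rfl⟩ := hv
      by_cases hc : c = 0
      · exact ⟨none, Subtype.ext (by simp [hc])⟩
      · exact ⟨some (i, Units.mk0 c hc), rfl⟩
  have htot : Nat.card {v // IsOffPoints p v} + Nat.card {v // ¬ IsOffPoints p v} =
      Fintype.card F ^ k := by
    rw [← Nat.card_sum, Nat.card_congr (Equiv.sumCompl (IsOffPoints p)), Nat.card_fun,
      Nat.card_fin, Nat.card_eq_fintype_card]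
  zify [hq] at hbad htot
  linarith

/-- Counting `n + 1`-tuples by removing the first entry. -/
theorem card_cons_eq_sum {X : Type*} [Fintype X] (A : (Fin n → X) → Prop)
    (P : (Fin (n + 1) → X) → Prop) (B : (Fin n → X) → X → Prop) (h : ∀ v p, P (Fin.cons v p) ↔ A p ∧ B p v)
    [Fintype {p // A p}] :
    Nat.card {p // P p} = ∑ p : {p // A p}, Nat.card {v // B p v} := by
  rw [← Nat.card_sigma]
  refine (Nat.card_eq_of_bijective
    (fun x : (Σ p : {p // A p}, {v // B p v}) =>
      (⟨Fin.cons x.2.1 x.1.1, (h _ _).2 ⟨x.1.2, x.2.2⟩⟩ : {p // P p})) ⟨?_, ?_⟩).symm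
  · rintro ⟨⟨p, hp⟩, v, hv⟩ ⟨⟨p', hp'⟩, v', hv'⟩ h
    have h' : (Fin.cons v p : Fin (n + 1) → X) = Fin.cons v' p' := congrArg Subtype.val h
    obtain ⟨rfl, rfl⟩ := Fin.cons_inj.1 h'
    rfl
  · rintro ⟨p, hp⟩
    have hp' := hp
    rw [← Fin.cons_self_tail p, h] at hp'
    exact ⟨⟨⟨Fin.tail p, hp'.1⟩, p 0, hp'.2⟩, Subtype.ext (Fin.cons_self_tail p)⟩

theorem card_cons_eq_mul {X : Type*} [Finite X] (A : (Fin n → X) → Prop)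
    (P : (Fin (n + 1) → X) → Prop)
    (B : (Fin n → X) → X → Prop) (h : ∀ v p, P (Fin.cons v p) ↔ A p ∧ B p v) (N : ℤ)
    (hN : ∀ p, A p → (Nat.card {v // B p v} : ℤ) = N) :
    (Nat.card {p // P p} : ℤ) = Nat.card {p // A p} * N := by
  have := Fintype.ofFinite X
  have := Fintype.ofFinite {p // A p}
  rw [card_cons_eq_sum A P B h, Nat.cast_sum, Finset.sum_congr rfl fun p _ => hN p.1 p.2]
  simp

theorem GenPos.ne_smul {p : Fin n → Fin k → F} (hp : GenPos F p) (hkn : k ≤ n) (hk : 2 ≤ k)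
    {i j : Fin n} (hij : i ≠ j) (c : F) : p i ≠ c • p j := by
  intro h
  have hli := hp.linearIndepOn hkn {i, j} (Finset.card_le_two.trans hk)
  rw [Finset.coe_pair, LinearIndepOn.pair_iff _ hij] at hli
  exact one_ne_zero (hli 1 (-c) (by rw [h]; module)).1

theorem GenPos.card_isOffPoints [Fintype F] {p : Fin n → Fin k → F} (hp : GenPos F p) (hkn : k ≤ n)
    (hk : 2 ≤ k) : (Nat.card {v // IsOffPoints p v} : ℤ) =
      (Fintype.card F : ℤ) ^ k - 1 - n * ((Fintype.card F : ℤ) - 1) :=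
  _root_.card_isOffPoints (by omega) (hp.ne_zero hkn (by omega))
    fun _ _ hij c => hp.ne_smul hkn hk hij c

theorem GenPos.comp {m : ℕ} {p : Fin n → Fin k → F} (hp : GenPos F p) {f : Fin m → Fin n}
    (hf : f.Injective) : GenPos F (p ∘ f) := fun e he => hp (f ∘ e) (hf.comp he)

theorem genPos_two_iff {p : Fin n → Fin 2 → F} :
    GenPos F p ↔ ∀ i j, i ≠ j → LinearIndependent F ![p i, p j] := by
  constructor
  · intro h i j hij
    have := h ![i, j] (by
      intro a b hab
      fin_cases a <;> fin_cases b <;> simp_all)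
    convert this using 1
    funext a
    fin_cases a <;> rfl
  · intro h e he
    convert h (e 0) (e 1) (fun h => by simpa using he h) using 1
    funext a
    fin_cases a <;> rfl

/-- The bound `2 ≤ n` matters: for smaller `n` general position is vacuous in dimension two and
would allow a zero member. -/
theorem genPos_two_cons (hn : 2 ≤ n) (v : Fin 2 → F) (p : Fin n → Fin 2 → F) :
    GenPos F (Fin.cons v p : Fin (n + 1) → Fin 2 → F) ↔ GenPos F p ∧ IsOffPoints p v := by
  constructor
  · intro h
    exact ⟨h.comp (Fin.succ_injective n), fun i c => by
      simpa using h.ne_smul (by omega) le_rfl (Fin.succ_ne_zero i).symm c⟩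
  · rintro ⟨hp, hv⟩
    have hne := hp.ne_zero hn (by omega)
    have hpv : ∀ i, LinearIndependent F ![p i, v] := fun i =>
      (LinearIndependent.pair_iff' (hne i)).2 fun c h => hv i c h.symm
    rw [genPos_two_iff]
    intro i j hij
    cases i using Fin.cases with
    | zero =>
      cases j using Fin.cases with
      | zero => exact absurd rfl hij
      | succ j => exact LinearIndependent.pair_symm_iff.1 (hpv j)
    | succ i =>
      cases j using Fin.cases with
      | zero => exact hpv i
      | succ j => exact genPos_two_iff.1 hp i j fun h => hij (by rw [h])

theorem card_genPos_two_succ [Fintype F] (hn : 2 ≤ n) :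
    (Nat.card {p : Fin (n + 1) → Fin 2 → F // GenPos F p} : ℤ) =
      Nat.card {p : Fin n → Fin 2 → F // GenPos F p} *
        ((Fintype.card F : ℤ) ^ 2 - 1 - n * ((Fintype.card F : ℤ) - 1)) :=
  card_cons_eq_mul _ _ _ (genPos_two_cons hn) _ fun _ hp => hp.card_isOffPoints hn le_rfl

end Extension

/-! ### Determinants in `F ^ 3` and the planes spanned by pairs. -/

section TripleProduct

variable {F : Type*} [Field F]

/-- The determinant of three vectors in `F ^ 3`. -/
def tri (u v w : Fin 3 → F) : F :=
  u 0 * (v 1 * w 2 - v 2 * w 1) - u 1 * (v 0 * w 2 - v 2 * w 0) + u 2 * (v 0 * w 1 - v 1 * w 0)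

theorem tri_rotate (u v w : Fin 3 → F) : tri u v w = tri v w u := by unfold tri; ring

theorem tri_swap (u v w : Fin 3 → F) : tri u v w = -tri v u w := by unfold tri; ring

@[simp] theorem tri_self_left (u w : Fin 3 → F) : tri u u w = 0 := by unfold tri; ring

@[simp] theorem tri_self_right (u w : Fin 3 → F) : tri u w w = 0 := by unfold tri; ring

@[simp] theorem tri_self_outer (u w : Fin 3 → F) : tri u w u = 0 := by unfold tri; ring

@[simp] theorem tri_smul_left (c : F) (u v w : Fin 3 → F) : tri (c • u) v w = c * tri u v w := by
  simp only [tri, Pi.smul_apply, smul_eq_mul]; ring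

@[simp] theorem tri_smul_mid (c : F) (u v w : Fin 3 → F) : tri u (c • v) w = c * tri u v w := by
  simp only [tri, Pi.smul_apply, smul_eq_mul]; ring

@[simp] theorem tri_smul_right (c : F) (u v w : Fin 3 → F) : tri u v (c • w) = c * tri u v w := by
  simp only [tri, Pi.smul_apply, smul_eq_mul]; ring

theorem tri_add_right (u v w w' : Fin 3 → F) : tri u v (w + w') = tri u v w + tri u v w' := by
  simp only [tri, Pi.add_apply]; ring

theorem tri_add_mid (u v v' w : Fin 3 → F) : tri u (v + v') w = tri u v w + tri u v' w := by
  simp only [tri, Pi.add_apply]; ring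

theorem tri_cramer (a b c v : Fin 3 → F) :
    tri a b c • v = tri v b c • a + tri a v c • b + tri a b v • c := by
  funext i
  simp only [tri, Pi.smul_apply, Pi.add_apply, smul_eq_mul]
  fin_cases i <;> simp <;> ring

theorem exists_coords {a b c : Fin 3 → F} (h : tri a b c ≠ 0) (v : Fin 3 → F) :
    ∃ x y z : F, v = x • a + y • b + z • c := by
  refine ⟨tri v b c / tri a b c, tri a v c / tri a b c, tri a b v / tri a b c, ?_⟩
  have := congrArg (fun w => (tri a b c)⁻¹ • w) (tri_cramer a b c v)
  simp only [smul_add, smul_smul, inv_mul_cancel₀ h, one_smul] at this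
  simpa only [div_eq_inv_mul] using this

theorem linearIndependent_iff_tri (u v w : Fin 3 → F) :
    LinearIndependent F ![u, v, w] ↔ tri u v w ≠ 0 := by
  have h : LinearIndependent F ![u, v, w] ↔ IsUnit (Matrix.of ![u, v, w]) :=
    Matrix.linearIndependent_rows_iff_isUnit (A := Matrix.of ![u, v, w])
  rw [h, Matrix.isUnit_iff_isUnit_det, isUnit_iff_ne_zero, Matrix.det_fin_three]
  have : tri u v w = u 0 * v 1 * w 2 - u 0 * v 2 * w 1 - u 1 * v 0 * w 2 + u 1 * v 2 * w 0 +
      u 2 * v 0 * w 1 - u 2 * v 1 * w 0 := by unfold tri; ring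
  rw [this]
  rfl

variable {n : ℕ}

theorem genPos_three_iff {p : Fin n → Fin 3 → F} :
    GenPos F p ↔ ∀ i j k, i ≠ j → i ≠ k → j ≠ k → tri (p i) (p j) (p k) ≠ 0 := by
  constructor
  · intro h i j k hij hik hjk
    rw [← linearIndependent_iff_tri]
    have := h ![i, j, k] (by
      intro a b hab
      fin_cases a <;> fin_cases b <;> simp_all)
    convert this using 1
    funext a
    fin_cases a <;> rfl
  · intro h e he
    have := (linearIndependent_iff_tri _ _ _).2 (h (e 0) (e 1) (e 2) (fun h => by simpa using he h)
      (fun h => by simpa using he h) (fun h => by simpa using he h))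
    convert this using 1
    funext a
    fin_cases a <;> rfl

/-- The vectors outside all the planes spanned by two members of the family `p`. -/
def IsOffPlanes (p : Fin n → Fin 3 → F) (v : Fin 3 → F) : Prop :=
  ∀ i j, i ≠ j → tri (p i) (p j) v ≠ 0

theorem genPos_three_cons (v : Fin 3 → F) (p : Fin n → Fin 3 → F) :
    GenPos F (Fin.cons v p : Fin (n + 1) → Fin 3 → F) ↔ GenPos F p ∧ IsOffPlanes p v := by
  simp only [genPos_three_iff]
  constructor
  · intro h
    refine ⟨fun i j k hij hik hjk => ?_, fun i j hij => ?_⟩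
    · exact h i.succ j.succ k.succ (by simpa) (by simpa) (by simpa)
    · exact h i.succ j.succ 0 (by simpa) (Fin.succ_ne_zero _) (Fin.succ_ne_zero _)
  · rintro ⟨hp, hv⟩ i j k hij hik hjk
    cases i using Fin.cases with
    | zero =>
      cases j using Fin.cases with
      | zero => exact absurd rfl hij
      | succ j =>
        cases k using Fin.cases with
        | zero => exact absurd rfl hik
        | succ k =>
          rw [tri_rotate]
          exact hv j k fun h => hjk (by rw [h])
    | succ i =>
      cases j using Fin.cases with
      | zero =>
        cases k using Fin.cases with
        | zero => exact absurd rfl hjk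
        | succ k =>
          rw [tri_rotate, tri_rotate]
          exact hv k i fun h => hik (by rw [h])
      | succ j =>
        cases k using Fin.cases with
        | zero => exact hv i j fun h => hij (by rw [h])
        | succ k =>
          exact hp i j k (fun h => hij (by rw [h])) (fun h => hik (by rw [h]))
            (fun h => hjk (by rw [h]))

theorem IsOffPlanes.isOffPoints (hn : 2 ≤ n) {p : Fin n → Fin 3 → F} {v : Fin 3 → F}
    (h : IsOffPlanes p v) : IsOffPoints p v := by
  rintro i c rfl
  have : Nontrivial (Fin n) := Fin.nontrivial_iff_two_le.2 hn
  obtain ⟨j, hj⟩ := exists_ne i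
  exact h i j hj.symm (by simp)

theorem exists_third (hn : 3 ≤ n) (i j : Fin n) : ∃ k : Fin n, k ≠ i ∧ k ≠ j := by
  obtain ⟨k, hk⟩ : ∃ k, k ∉ ({i, j} : Finset (Fin n)) := by
    by_contra! h
    have := Finset.card_le_card (fun k _ => h k : (Finset.univ : Finset (Fin n)) ⊆ {i, j})
    have h2 := Finset.card_le_two (a := i) (b := j)
    rw [Finset.card_univ, Fintype.card_fin] at this
    omega
  exact ⟨k, by simpa using hk⟩

/-- A third member of `p` lies outside the plane of `p i` and `p j`, and the two nonzero
coefficients rule out multiples of `p i` and `p j` themselves. -/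
theorem GenPos.isOffPoints_combination {p : Fin n → Fin 3 → F} (hp : GenPos F p) (hn : 3 ≤ n)
    {i j : Fin n} (hij : i ≠ j) {x y : F} (hx : x ≠ 0) (hy : y ≠ 0) :
    IsOffPoints p (x • p i + y • p j) := by
  rw [genPos_three_iff] at hp
  intro l c h
  obtain ⟨k, hki, hkj⟩ := exists_third hn i j
  have hD := hp i j k hij hki.symm hkj.symm
  by_cases hli : l = i
  · subst hli
    have := congrArg (fun w => tri (p l) w (p k)) h
    simp [tri_add_mid, hy, hD] at this
  by_cases hlj : l = j
  · subst hlj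
    have := congrArg (fun w => tri (p l) w (p k)) h
    rw [tri_swap] at hD
    simp [tri_add_mid, hx] at this hD
    exact hD this
  have hc := congrArg (fun w => tri (p i) (p j) w) h
  simp only [tri_add_right, tri_smul_right, tri_self_outer, tri_self_right, mul_zero,
    add_zero, zero_eq_mul, hp i j l hij (Ne.symm hli) (Ne.symm hlj), or_false] at hc
  have := congrArg (fun w => tri (p i) w (p k)) h
  simp only [tri_add_mid, tri_smul_mid, tri_self_left, mul_zero, zero_add, hc, zero_mul,
    mul_eq_zero, hy, hD, or_self] at this

theorem GenPos.isOffPoints_and_tri_eq_zero_iff {p : Fin n → Fin 3 → F} (hp : GenPos F p)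
    (hn : 3 ≤ n) {i j : Fin n} (hij : i ≠ j) (v : Fin 3 → F) :
    IsOffPoints p v ∧ tri (p i) (p j) v = 0 ↔
      ∃ x y : F, x ≠ 0 ∧ y ≠ 0 ∧ v = x • p i + y • p j := by
  constructor
  · rintro ⟨hv, h0⟩
    obtain ⟨k, hki, hkj⟩ := exists_third hn i j
    have hD := genPos_three_iff.1 hp i j k hij hki.symm hkj.symm
    obtain ⟨x, y, z, rfl⟩ := exists_coords hD v
    simp [tri_add_right, hD] at h0
    subst h0
    refine ⟨x, y, ?_, ?_, by simp⟩
    · rintro rfl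
      exact hv j y (by simp)
    · rintro rfl
      exact hv i x (by simp)
  · rintro ⟨x, y, hx, hy, rfl⟩
    exact ⟨hp.isOffPoints_combination hn hij hx hy, by simp [tri_add_right]⟩

theorem GenPos.combination_injective {p : Fin n → Fin 3 → F} (hp : GenPos F p)
    (hn : 3 ≤ n) {i j : Fin n} (hij : i ≠ j) {x y x' y' : F}
    (h : x • p i + y • p j = x' • p i + y' • p j) : x = x' ∧ y = y' := by
  have hli := hp.linearIndepOn hn {i, j} (Finset.card_le_two.trans (by norm_num))
  rw [Finset.coe_pair, LinearIndepOn.pair_iff _ hij] at hli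
  have := hli (x - x') (y - y') (by
    rw [sub_smul, sub_smul]
    rw [← sub_eq_zero] at h
    rw [← h]
    abel)
  exact ⟨sub_eq_zero.1 this.1, sub_eq_zero.1 this.2⟩

theorem GenPos.card_plane [Finite F] {p : Fin n → Fin 3 → F} (hp : GenPos F p)
    (hn : 3 ≤ n) {i j : Fin n} (hij : i ≠ j) :
    Nat.card {v // IsOffPoints p v ∧ tri (p i) (p j) v = 0} = (Nat.card F - 1) ^ 2 := by
  have hu : (Nat.card F - 1) ^ 2 = Nat.card (Fˣ × Fˣ) := by
    rw [Nat.card_prod, Nat.card_units, sq]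
  rw [hu]
  refine (Nat.card_eq_of_bijective (fun x : Fˣ × Fˣ =>
    (⟨(x.1 : F) • p i + (x.2 : F) • p j, (hp.isOffPoints_and_tri_eq_zero_iff hn hij _).2
      ⟨x.1, x.2, x.1.ne_zero, x.2.ne_zero, rfl⟩⟩ :
      {v // IsOffPoints p v ∧ tri (p i) (p j) v = 0})) ⟨?_, ?_⟩).symm
  · intro x y h
    obtain ⟨h1, h2⟩ := hp.combination_injective hn hij (congrArg Subtype.val h)
    exact Prod.ext (Units.ext h1) (Units.ext h2)
  · rintro ⟨v, hv⟩
    obtain ⟨x, y, hx, hy, rfl⟩ := (hp.isOffPoints_and_tri_eq_zero_iff hn hij _).1 hv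
    exact ⟨(Units.mk0 x hx, Units.mk0 y hy), rfl⟩

theorem GenPos.card_two_planes [Finite F] {p : Fin n → Fin 3 → F} (hp : GenPos F p)
    (hn : 3 ≤ n) {i j k l : Fin n} (hij : i ≠ j) (hkl : k ≠ l) (hik : i ≠ k) (hil : i ≠ l)
    (hjk : j ≠ k) (hjl : j ≠ l) :
    Nat.card {v // IsOffPoints p v ∧ tri (p i) (p j) v = 0 ∧ tri (p k) (p l) v = 0} =
      Nat.card F - 1 := by
  have hi := genPos_three_iff.1 hp k l i hkl hik.symm hil.symm
  have hj := genPos_three_iff.1 hp k l j hkl hjk.symm hjl.symm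
  have hu : Nat.card F - 1 = Nat.card Fˣ := by rw [Nat.card_units]
  rw [hu]
  -- The two planes meet in one line. Its generator is the combination of `p i` and `p j` killed by
  -- `tri (p k) (p l)`; both coefficients are nonzero by general position.
  refine (Nat.card_eq_of_bijective (fun s : Fˣ =>
    (⟨(s * tri (p k) (p l) (p j)) • p i + (-(s * tri (p k) (p l) (p i))) • p j, ?_⟩ :
      {v // IsOffPoints p v ∧ tri (p i) (p j) v = 0 ∧ tri (p k) (p l) v = 0})) ⟨?_, ?_⟩).symm
  · rw [← and_assoc]
    refine ⟨(hp.isOffPoints_and_tri_eq_zero_iff hn hij _).2 ⟨_, _, ?_, ?_, rfl⟩, ?_⟩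
    · exact mul_ne_zero s.ne_zero hj
    · exact neg_ne_zero.2 (mul_ne_zero s.ne_zero hi)
    · rw [tri_add_right, tri_smul_right, tri_smul_right]
      ring
  · intro s t h
    obtain ⟨h1, -⟩ := hp.combination_injective hn hij (congrArg Subtype.val h)
    exact Units.ext (mul_right_cancel₀ hj h1)
  · rintro ⟨v, hv, h1, h2⟩
    obtain ⟨x, y, hx, hy, rfl⟩ := (hp.isOffPoints_and_tri_eq_zero_iff hn hij _).1 ⟨hv, h1⟩
    refine ⟨Units.mk0 (x / tri (p k) (p l) (p j)) (div_ne_zero hx hj), Subtype.ext ?_⟩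
    rw [tri_add_right, tri_smul_right, tri_smul_right] at h2
    simp only [Units.val_mk0]
    congr 2
    · field_simp
    · field_simp
      linear_combination -h2

/-- The planes through `p i, p j` and `p i, p k` meet only in the line of `p i`, which `hv`
excludes. -/
theorem GenPos.not_adjacent_planes {p : Fin n → Fin 3 → F} (hp : GenPos F p)
    (hn : 3 ≤ n) {i j k : Fin n} (hij : i ≠ j) (hik : i ≠ k) (hjk : j ≠ k) {v : Fin 3 → F}
    (hv : IsOffPoints p v) (h1 : tri (p i) (p j) v = 0) : tri (p i) (p k) v ≠ 0 := by
  obtain ⟨x, y, hx, hy, rfl⟩ := (hp.isOffPoints_and_tri_eq_zero_iff hn hij _).1 ⟨hv, h1⟩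
  have := genPos_three_iff.1 hp i k j hik hij hjk.symm
  simp [tri_add_right, hy, this]

end TripleProduct

/-! ### Inclusion and exclusion over sets of disjoint pairs. -/

section InclusionExclusion

variable {n : ℕ}

/-- The pairs `i < j` of indices, which name the planes spanned by two members of a family. -/
def indexPairs (n : ℕ) : Finset (Fin n × Fin n) :=
  Finset.univ.filter fun s => s.1 < s.2

/-- The two pairs have no index in common. -/
abbrev DisjointPairs (s t : Fin n × Fin n) : Prop :=
  s.1 ≠ t.1 ∧ s.1 ≠ t.2 ∧ s.2 ≠ t.1 ∧ s.2 ≠ t.2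

/-- The sets of `r` pairwise disjoint pairs of indices. -/
def matchings (n r : ℕ) : Finset (Finset (Fin n × Fin n)) :=
  (Finset.powersetCard r (indexPairs n)).filter
    fun m => ∀ s ∈ m, ∀ t ∈ m, s ≠ t → DisjointPairs s t

theorem mem_matchings {r : ℕ} {m : Finset (Fin n × Fin n)} :
    m ∈ matchings n r ↔ (m ⊆ indexPairs n ∧ m.card = r) ∧
      ∀ s ∈ m, ∀ t ∈ m, s ≠ t → DisjointPairs s t := by
  rw [matchings, Finset.mem_filter, Finset.mem_powersetCard]

theorem two_mul_card_le_of_matching {m : Finset (Fin n × Fin n)} (hm : m ⊆ indexPairs n)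
    (hd : ∀ s ∈ m, ∀ t ∈ m, s ≠ t → DisjointPairs s t) : 2 * m.card ≤ n := by
  have hcard : (m.biUnion fun s => ({s.1, s.2} : Finset (Fin n))).card = 2 * m.card := by
    rw [Finset.card_biUnion, Finset.sum_congr rfl (g := fun _ => 2), Finset.sum_const,
      smul_eq_mul, mul_comm]
    · intro s hs
      have := hm hs
      rw [indexPairs, Finset.mem_filter] at this
      exact Finset.card_pair this.2.ne
    · intro s hs t ht hst
      obtain ⟨h1, h2, h3, h4⟩ := hd s hs t ht hst
      simp [h1.symm, h2.symm, h3.symm, h4.symm]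
  have := Finset.card_le_univ (m.biUnion fun s => ({s.1, s.2} : Finset (Fin n)))
  rwa [hcard, Fintype.card_fin] at this

/-- This is `(1 - 1) ^ c` expanded; the bound on `c` is what allows stopping after the third
binomial. -/
theorem ite_eq_zero_eq_alternating {c : ℕ} (hc : c ≤ 3) :
    (if c = 0 then 1 else 0 : ℤ) = 1 - c.choose 1 + c.choose 2 - c.choose 3 := by
  interval_cases c <;> decide

variable {F : Type*} [Field F]

theorem isOffPlanes_iff_indexPairs {p : Fin n → Fin 3 → F} (hn : 2 ≤ n)
    (v : Fin 3 → F) :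
    IsOffPlanes p v ↔ IsOffPoints p v ∧ ∀ s ∈ indexPairs n, tri (p s.1) (p s.2) v ≠ 0 := by
  constructor
  · intro h
    refine ⟨h.isOffPoints hn, fun s hs => h _ _ ?_⟩
    rw [indexPairs, Finset.mem_filter] at hs
    exact hs.2.ne
  · rintro ⟨-, h⟩ i j hij
    rcases lt_or_gt_of_ne hij with hlt | hlt
    · exact h (i, j) (by simpa [indexPairs] using hlt)
    · rw [tri_swap]
      exact neg_ne_zero.2 (h (j, i) (by simpa [indexPairs] using hlt))

theorem GenPos.disjointPairs {p : Fin n → Fin 3 → F} (hp : GenPos F p) (hn : 3 ≤ n)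
    {v : Fin 3 → F} (hv : IsOffPoints p v) {s t : Fin n × Fin n} (hs : s ∈ indexPairs n)
    (ht : t ∈ indexPairs n) (hst : s ≠ t) (hs0 : tri (p s.1) (p s.2) v = 0)
    (ht0 : tri (p t.1) (p t.2) v = 0) : DisjointPairs s t := by
  obtain ⟨a, b⟩ := s
  obtain ⟨c, d⟩ := t
  simp only [indexPairs, Finset.mem_filter, Finset.mem_univ, true_and] at hs ht
  have hs0' : tri (p b) (p a) v = 0 := by rw [tri_swap, hs0, neg_zero]
  have ht0' : tri (p d) (p c) v = 0 := by rw [tri_swap, ht0, neg_zero]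
  simp only at hs0 ht0
  refine ⟨?_, ?_, ?_, ?_⟩ <;> rintro h <;> simp only at h <;> subst h
  · exact hp.not_adjacent_planes hn hs.ne ht.ne (fun h => hst (by rw [h])) hv hs0 ht0
  · exact hp.not_adjacent_planes hn hs.ne ht.ne' (ht.trans hs).ne' hv hs0 ht0'
  · exact hp.not_adjacent_planes hn hs.ne' ht.ne (hs.trans ht).ne hv hs0' ht0
  · exact hp.not_adjacent_planes hn hs.ne' ht.ne' (fun h => hst (by rw [h])) hv hs0' ht0'

/-- Double counting of the pairs consisting of an element `v` of `U` and an `r`-set of conditions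
from `P` that all hold at `v`. -/
theorem sum_choose_card_filter {α β : Type*} [DecidableEq β] (U : Finset α) (P : Finset β)
    (R : α → β → Prop)
    [∀ v, DecidablePred (R v)] (r : ℕ) :
    ∑ v ∈ U, (P.filter (R v)).card.choose r =
      ∑ σ ∈ P.powersetCard r, (U.filter fun v => ∀ s ∈ σ, R v s).card := by
  have h : ∀ v, (P.filter (R v)).card.choose r =
      ∑ σ ∈ P.powersetCard r, if ∀ s ∈ σ, R v s then 1 else 0 := by
    intro v
    rw [← Finset.card_powersetCard, ← Finset.card_filter]
    congr 1
    ext σ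
    simp only [Finset.mem_powersetCard, Finset.mem_filter, Finset.subset_iff]
    constructor
    · rintro ⟨h, hr⟩
      exact ⟨⟨fun s hs => (h hs).1, hr⟩, fun s hs => (h hs).2⟩
    · rintro ⟨⟨h, hr⟩, h'⟩
      exact ⟨fun s hs => ⟨h hs, h' s hs⟩, hr⟩
  rw [Finset.sum_congr rfl fun v _ => h v, Finset.sum_comm]
  exact Finset.sum_congr rfl fun σ _ => (Finset.card_filter _ _).symm

/-- Inclusion and exclusion over the planes: off the points of an arc of at most six points, a
vector lies on at most three of the planes spanned by two points. -/
theorem GenPos.card_isOffPlanes [Fintype F] {p : Fin n → Fin 3 → F} (hp : GenPos F p)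
    (hn : 3 ≤ n) (hn6 : n ≤ 6) :
    (Nat.card {v // IsOffPlanes p v} : ℤ) =
      (Fintype.card F : ℤ) ^ 3 - 1 - n * ((Fintype.card F : ℤ) - 1)
        - (indexPairs n).card * ((Fintype.card F : ℤ) - 1) ^ 2
        + (matchings n 2).card * ((Fintype.card F : ℤ) - 1)
        - ∑ τ ∈ matchings n 3,
            (Nat.card {v // IsOffPoints p v ∧ ∀ s ∈ τ, tri (p s.1) (p s.2) v = 0} : ℤ) := by
  classical
  let U : Finset (Fin 3 → F) := Finset.univ.filter (IsOffPoints p)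
  let m : (Fin 3 → F) → Finset (Fin n × Fin n) := fun v =>
    (indexPairs n).filter fun s => tri (p s.1) (p s.2) v = 0
  have hq : 1 ≤ Fintype.card F := Fintype.card_pos
  have hdisj : ∀ v ∈ U, ∀ s ∈ m v, ∀ t ∈ m v, s ≠ t → DisjointPairs s t := by
    intro v hv s hs t ht hst
    simp only [m, U, Finset.mem_filter, Finset.mem_univ, true_and] at hs ht hv
    exact hp.disjointPairs hn hv hs.1 ht.1 hst hs.2 ht.2
  -- The planes through `v` are named by disjoint pairs of indices, so `n ≤ 6` leaves room for
  -- three.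
  have hm3 : ∀ v ∈ U, (m v).card ≤ 3 := by
    intro v hv
    have : 2 * (m v).card ≤ n :=
      two_mul_card_le_of_matching (Finset.filter_subset _ _) (hdisj v hv)
    omega
  have hcardU : (U.card : ℤ) =
      (Fintype.card F : ℤ) ^ 3 - 1 - n * ((Fintype.card F : ℤ) - 1) := by
    rw [← hp.card_isOffPoints hn (by norm_num), Nat.card_eq_fintype_card, Fintype.card_subtype]
  have hgood : (Nat.card {v // IsOffPlanes p v} : ℤ) =
      ∑ v ∈ U, if (m v).card = 0 then 1 else 0 := by
    rw [Nat.card_eq_fintype_card, Fintype.card_subtype, Finset.sum_boole]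
    congr 2
    ext v
    simp only [Finset.mem_filter, Finset.mem_univ, true_and, U, m, Finset.card_eq_zero,
      Finset.filter_eq_empty_iff]
    exact isOffPlanes_iff_indexPairs (by omega) v
  have hfib : ∀ r, ∑ v ∈ U, ((m v).card.choose r : ℤ) = ∑ σ ∈ matchings n r,
      (Nat.card {v // IsOffPoints p v ∧ ∀ s ∈ σ, tri (p s.1) (p s.2) v = 0} : ℤ) := by
    intro r
    have h := sum_choose_card_filter U (indexPairs n)
      (fun v s => tri (p s.1) (p s.2) v = 0) r
    have h' := congrArg (Nat.cast : ℕ → ℤ) h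
    rw [Nat.cast_sum, Nat.cast_sum] at h'
    rw [h', matchings, Finset.sum_filter]
    refine Finset.sum_congr rfl fun σ hσ => ?_
    rw [Finset.mem_powersetCard] at hσ
    split_ifs with hd
    · rw [Nat.card_eq_fintype_card, Fintype.card_subtype, Finset.filter_filter]
      congr
    -- If `σ` contains two pairs with a common index, no vector of `U` lies on all its planes, so
    -- only matchings contribute.
    · rw [Nat.cast_eq_zero, Finset.card_eq_zero, Finset.eq_empty_iff_forall_notMem]
      intro v hv0
      simp only [Finset.mem_filter] at hv0
      obtain ⟨hv, h0⟩ := hv0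
      refine hd fun s hs t ht hst => hdisj v hv s ?_ t ?_ hst
      · exact Finset.mem_filter.2 ⟨hσ.1 hs, h0 s hs⟩
      · exact Finset.mem_filter.2 ⟨hσ.1 ht, h0 t ht⟩
  have h1 : ∑ v ∈ U, ((m v).card.choose 1 : ℤ) =
      (indexPairs n).card * ((Fintype.card F : ℤ) - 1) ^ 2 := by
    have h := sum_choose_card_filter U (indexPairs n)
      (fun v s => tri (p s.1) (p s.2) v = 0) 1
    rw [Finset.powersetCard_one, Finset.sum_map] at h
    have h' := congrArg (Nat.cast : ℕ → ℤ) h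
    rw [Nat.cast_sum, Nat.cast_sum] at h'
    rw [h', Finset.sum_congr rfl (g := fun _ => ((Fintype.card F : ℤ) - 1) ^ 2), Finset.sum_const,
      nsmul_eq_mul]
    intro s hs
    simp only [indexPairs, Finset.mem_filter] at hs
    have := hp.card_plane hn hs.2.ne
    rw [Nat.card_eq_fintype_card, Fintype.card_subtype, Nat.card_eq_fintype_card] at this
    zify [hq] at this
    rw [← this, Finset.filter_filter]
    simp
  have h2 : ∑ v ∈ U, ((m v).card.choose 2 : ℤ) =
      (matchings n 2).card * ((Fintype.card F : ℤ) - 1) := by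
    rw [hfib, Finset.sum_congr rfl (g := fun _ => ((Fintype.card F : ℤ) - 1)), Finset.sum_const,
      nsmul_eq_mul]
    intro σ hσ
    obtain ⟨⟨hsub, h2⟩, hd⟩ := mem_matchings.1 hσ
    obtain ⟨s, t, hst, rfl⟩ := Finset.card_eq_two.1 h2
    obtain ⟨d1, d2, d3, d4⟩ := hd s (by simp) t (by simp) hst
    have hs := hsub (Finset.mem_insert_self s _)
    have ht := hsub (show t ∈ {s, t} by simp)
    simp only [indexPairs, Finset.mem_filter] at hs ht
    have := hp.card_two_planes hn hs.2.ne ht.2.ne d1 d2 d3 d4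
    rw [Nat.card_eq_fintype_card (α := F)] at this
    zify [hq] at this
    rw [← this]
    simp
  rw [hgood, Finset.sum_congr rfl fun v hv => ite_eq_zero_eq_alternating (hm3 v hv)]
  rw [Finset.sum_sub_distrib, Finset.sum_add_distrib, Finset.sum_sub_distrib, h1, h2, hfib 3,
    ← hcardU]
  simp

theorem card_indexPairs_matchings :
    (indexPairs 3).card = 3 ∧ (indexPairs 4).card = 6 ∧ (indexPairs 5).card = 10 ∧
    (indexPairs 6).card = 15 ∧ (matchings 3 2).card = 0 ∧ (matchings 4 2).card = 3 ∧
    (matchings 5 2).card = 15 ∧ (matchings 6 2).card = 45 ∧ (matchings 6 3).card = 15 := by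
  decide +kernel

theorem matchings_eq_empty {r : ℕ} (h : n < 2 * r) : matchings n r = ∅ := by
  rw [Finset.eq_empty_iff_forall_notMem]
  intro m hm
  obtain ⟨⟨hsub, rfl⟩, hd⟩ := mem_matchings.1 hm
  have := two_mul_card_le_of_matching hsub hd
  omega

/-- At most five indices leave no room for three disjoint pairs, so the triple term vanishes and the
number of extensions is the same for every tuple. -/
theorem card_genPos_three_succ [Fintype F] (hn : 3 ≤ n) (hn5 : n ≤ 5) :
    (Nat.card {p : Fin (n + 1) → Fin 3 → F // GenPos F p} : ℤ) =
      Nat.card {p : Fin n → Fin 3 → F // GenPos F p} *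
      ((Fintype.card F : ℤ) ^ 3 - 1 - n * ((Fintype.card F : ℤ) - 1)
        - (indexPairs n).card * ((Fintype.card F : ℤ) - 1) ^ 2
        + (matchings n 2).card * ((Fintype.card F : ℤ) - 1)) :=
  card_cons_eq_mul _ _ _ genPos_three_cons _ fun p hp => by
    rw [hp.card_isOffPlanes hn (by omega), matchings_eq_empty (by omega : n < 2 * 3)]
    simp

end InclusionExclusion

/-! ### Counting the parameters of concurrent configurations. -/

section Concurrence

variable {F : Type*} [Field F]

/-- The parameters of the pairs of points which complete the standard frame of the plane to an arc
in such a way that the line joining them passes through a given diagonal point. -/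
def IsConcurrenceParam (x y z : F) : Prop :=
  (x ≠ 0 ∧ x ≠ 1) ∧ (y ≠ 0 ∧ y ≠ 1 ∧ y ≠ x) ∧
    (z ≠ 0 ∧ z ≠ -x ∧ z ≠ 1 - x ∧ z ≠ -y ∧ z ≠ 1 - y)

theorem natCast_card_filter_notMem {α : Type*} [Fintype α] [DecidableEq α] (s : Finset α) :
    ((Finset.univ.filter fun z => z ∉ s).card : ℤ) = (Fintype.card α : ℤ) - s.card := by
  have h : (Finset.univ.filter fun z => z ∉ s) = sᶜ := by ext; simp
  rw [h, Finset.card_compl, Nat.cast_sub (Finset.card_le_univ s)]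

theorem two_eq_zero_iff_two_dvd_card [Fintype F] : (2 : F) = 0 ↔ 2 ∣ Fintype.card F := by
  obtain ⟨p, hp⟩ := CharP.exists F
  obtain ⟨m, hprime, hcard⟩ := FiniteField.card F p
  rw [hcard]
  have h2 : (2 : F) = 0 ↔ p ∣ 2 := by
    have := CharP.cast_eq_zero_iff F p 2
    exact_mod_cast this
  rw [h2, Nat.prime_dvd_prime_iff_eq hprime Nat.prime_two]
  constructor
  · rintro rfl
    exact dvd_pow_self _ m.pos.ne'
  · intro h
    exact ((Nat.prime_dvd_prime_iff_eq Nat.prime_two hprime).1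
      (Nat.prime_two.dvd_of_dvd_pow h)).symm

/-- This is where the parity of `q` enters: `1` and `-1` coincide exactly in characteristic two. -/
theorem card_zero_one_neg_one [Fintype F] [DecidableEq F] :
    ((({0, 1, -1} : Finset F).card : ℕ) : ℤ) = 3 - evenIndicator (Fintype.card F) := by
  rw [evenIndicator]
  by_cases h : (2 : F) = 0
  · rw [if_pos (two_eq_zero_iff_two_dvd_card.1 h)]
    have : (-1 : F) = 1 := by linear_combination -h
    rw [this]
    simp
  · rw [if_neg (fun h' => h (two_eq_zero_iff_two_dvd_card.2 h'))]
    have : (1 : F) ≠ -1 := fun h' => h (by linear_combination h')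
    rw [Finset.card_insert_of_notMem, Finset.card_pair this]
    · norm_num
    · simp

/-- Among the five values the only possible coincidences are `-x = 1 - y` and `-y = 1 - x`. In
characteristic two these occur together. -/
theorem card_forbidden [DecidableEq F] {x y : F} (hx0 : x ≠ 0) (hx1 : x ≠ 1) (hy0 : y ≠ 0)
    (hy1 : y ≠ 1) (hxy : y ≠ x) :
    ((({0, -x, 1 - x, -y, 1 - y} : Finset F).card : ℕ) : ℤ) =
      5 - (if y = x + 1 then 1 else 0) - (if y + 1 = x then 1 else 0) := by
  have e1 : (1 - y = -x) ↔ (y = x + 1) :=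
    ⟨fun h => by linear_combination -h, fun h => by linear_combination -h⟩
  have e2 : (1 - x = -y) ↔ (y + 1 = x) :=
    ⟨fun h => by linear_combination h, fun h => by linear_combination h⟩
  have n1 : -x ≠ 1 - x := fun h => one_ne_zero (by linear_combination -h : (1 : F) = 0)
  have n2 : -y ≠ 1 - y := fun h => one_ne_zero (by linear_combination -h : (1 : F) = 0)
  have n3 : -x ≠ -y := fun h => hxy (by linear_combination h)
  have n4 : 1 - x ≠ 1 - y := fun h => hxy (by linear_combination h)
  have n5 : (0 : F) ≠ 1 - x := fun h => hx1 (by linear_combination h)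
  have n6 : (0 : F) ≠ 1 - y := fun h => hy1 (by linear_combination h)
  have n7 : (0 : F) ≠ -x := fun h => hx0 (by linear_combination h)
  have n8 : (0 : F) ≠ -y := fun h => hy0 (by linear_combination h)
  rw [Finset.card_insert_of_notMem (by simp [n5, n6, hx0, hy0])]
  by_cases h1 : y = x + 1 <;> by_cases h2 : y + 1 = x
  · rw [if_pos h1, if_pos h2, e1.2 h1, e2.2 h2]
    have : ({-x, -y, -y, -x} : Finset F) = {-x, -y} := by ext; simp; tauto
    rw [this, Finset.card_pair n3]
    norm_num
  · rw [if_pos h1, if_neg h2, e1.2 h1]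
    have : ({-x, 1 - x, -y, -x} : Finset F) = {-x, 1 - x, -y} := by ext; simp; tauto
    rw [this, Finset.card_insert_of_notMem (by simp [n1]; simpa using n3),
      Finset.card_pair (mt e2.1 h2)]
    norm_num
  · rw [if_neg h1, if_pos h2, e2.2 h2]
    have : ({-x, -y, -y, 1 - y} : Finset F) = {-x, -y, 1 - y} := by ext; simp
    rw [this, Finset.card_insert_of_notMem, Finset.card_pair n2]
    · norm_num
    · simp only [Finset.mem_insert, Finset.mem_singleton, not_or]
      exact ⟨n3, fun h => h1 (e1.1 h.symm)⟩
  · rw [if_neg h1, if_neg h2, Finset.card_insert_of_notMem, Finset.card_insert_of_notMem,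
      Finset.card_pair n2]
    · norm_num
    · simp only [Finset.mem_insert, Finset.mem_singleton, not_or]
      exact ⟨mt e2.1 h2, n4⟩
    · simp only [Finset.mem_insert, Finset.mem_singleton, not_or]
      exact ⟨n1, n3, fun h => h1 (e1.1 h.symm)⟩

/-- For fixed `x` and `y` there are `q - 5` choices of `z`, plus one for each coincidence among the
forbidden values. Each coincidence `y = x + 1`, `y = x - 1` happens for `q - 3 + a(q)` admissible
pairs, so the total is `(q - 2)(q - 3)(q - 5) + 2(q - 3) + 2a(q)`. -/
theorem card_isConcurrenceParam [Fintype F] :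
    (Nat.card {t : F × F × F // IsConcurrenceParam t.1 t.2.1 t.2.2} : ℤ) =
      ((Fintype.card F : ℤ) - 3) ^ 2 * ((Fintype.card F : ℤ) - 4) +
        2 * evenIndicator (Fintype.card F) := by
  classical
  have hcount : (Nat.card {t : F × F × F // IsConcurrenceParam t.1 t.2.1 t.2.2} : ℤ) =
      ∑ x ∈ Finset.univ.filter (fun x : F => x ∉ ({0, 1} : Finset F)),
        ∑ y ∈ Finset.univ.filter (fun y : F => y ∉ ({0, 1, x} : Finset F)),
          ((Finset.univ.filter
            fun z : F => z ∉ ({0, -x, 1 - x, -y, 1 - y} : Finset F)).card : ℤ) := by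
    rw [Nat.card_eq_fintype_card, Fintype.card_subtype, Finset.card_filter,
      Fintype.sum_prod_type, Nat.cast_sum, Finset.sum_filter]
    refine Finset.sum_congr rfl fun x _ => ?_
    rw [Fintype.sum_prod_type, Nat.cast_sum]
    by_cases hx : x ∉ ({0, 1} : Finset F)
    · rw [if_pos hx, Finset.sum_filter]
      refine Finset.sum_congr rfl fun y _ => ?_
      by_cases hy : y ∉ ({0, 1, x} : Finset F)
      · rw [if_pos hy, Finset.card_filter]
        congr 1
        refine Finset.sum_congr rfl fun z _ => ?_
        simp only [Finset.mem_insert, Finset.mem_singleton, not_or] at hx hy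
        simp [IsConcurrenceParam, hx, hy]
      · rw [if_neg hy, Nat.cast_eq_zero]
        refine Finset.sum_eq_zero fun z _ => if_neg fun h => hy ?_
        simpa using h.2.1
    · rw [if_neg hx]
      refine Finset.sum_eq_zero fun y _ => ?_
      rw [Nat.cast_eq_zero]
      refine Finset.sum_eq_zero fun z _ => if_neg fun h => hx ?_
      simpa using h.1
  -- Given `x ≠ 0, 1`, the value `y = x + 1` can only be inadmissible by being `0`.
  have hshift : ∀ (x : F), x ∉ ({0, 1} : Finset F) →
      (∑ y ∈ Finset.univ.filter (fun y : F => y ∉ ({0, 1, x} : Finset F)),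
        if y = x + 1 then (1 : ℤ) else 0) = if x ∉ ({0, 1, -1} : Finset F) then 1 else 0 := by
    intro x hx
    rw [Finset.sum_ite_eq']
    simp only [Finset.mem_insert, Finset.mem_singleton, not_or, Finset.mem_filter,
      Finset.mem_univ, true_and] at hx ⊢
    have : x + 1 = 0 ↔ x = -1 := eq_neg_iff_add_eq_zero.symm
    simp [hx, this]
  -- Here `y = x - 1` can only be inadmissible by being `1`.
  have hshift' : ∀ (x : F), x ∉ ({0, 1} : Finset F) →
      (∑ y ∈ Finset.univ.filter (fun y : F => y ∉ ({0, 1, x} : Finset F)),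
        if y + 1 = x then (1 : ℤ) else 0) = if x ∉ ({0, 1, 2} : Finset F) then 1 else 0 := by
    intro x hx
    have h1 : ∀ y, (y + 1 = x) ↔ y = x - 1 := fun y => eq_sub_iff_add_eq.symm
    simp only [h1]
    rw [Finset.sum_ite_eq']
    simp only [Finset.mem_insert, Finset.mem_singleton, not_or, Finset.mem_filter,
      Finset.mem_univ, true_and] at hx ⊢
    have h2 : x - 1 = 1 ↔ x = 2 := by rw [sub_eq_iff_eq_add, one_add_one_eq_two]
    simp [hx, h2, sub_eq_zero]
  -- Translation by `1` carries `{0, 1, -1}` to `{0, 1, 2}`.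
  have hcard2 : ((({0, 1, 2} : Finset F).card : ℕ) : ℤ) = 3 - evenIndicator (Fintype.card F) := by
    rw [← card_zero_one_neg_one, ← Finset.card_map (Equiv.addRight (1 : F)).toEmbedding
      (s := {0, 1, -1})]
    congr 2
    ext y
    simp only [Finset.mem_insert, Finset.mem_singleton, Finset.map_insert, Finset.map_singleton,
      Equiv.coe_toEmbedding, Equiv.coe_addRight, zero_add, neg_add_cancel, one_add_one_eq_two]
    tauto
  have hrestrict : ∀ c : F,
      (∑ x ∈ Finset.univ.filter (fun x : F => x ∉ ({0, 1} : Finset F)),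
        if x ∉ ({0, 1, c} : Finset F) then (1 : ℤ) else 0) =
      (Fintype.card F : ℤ) - ({0, 1, c} : Finset F).card := by
    intro c
    rw [← natCast_card_filter_notMem, Finset.sum_boole, Finset.filter_filter]
    congr 2
    ext x
    simp only [Finset.mem_insert, Finset.mem_singleton, not_or, Finset.mem_filter]
    tauto
  have hinner : ∀ x ∈ Finset.univ.filter (fun x : F => x ∉ ({0, 1} : Finset F)),
      ∑ y ∈ Finset.univ.filter (fun y : F => y ∉ ({0, 1, x} : Finset F)),
          ((Finset.univ.filter
            fun z : F => z ∉ ({0, -x, 1 - x, -y, 1 - y} : Finset F)).card : ℤ) =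
        ((Fintype.card F : ℤ) - 3) * ((Fintype.card F : ℤ) - 5) +
          (if x ∉ ({0, 1, -1} : Finset F) then 1 else 0) +
          (if x ∉ ({0, 1, 2} : Finset F) then 1 else 0) := by
    intro x hx
    rw [Finset.mem_filter] at hx
    rw [← hshift x hx.2, ← hshift' x hx.2]
    have h3 : (({0, 1, x} : Finset F).card : ℤ) = 3 := by
      have hx' := hx.2
      simp only [Finset.mem_insert, Finset.mem_singleton, not_or] at hx'
      rw [Finset.card_insert_of_notMem, Finset.card_pair (Ne.symm hx'.2)]
      · norm_num
      · simp [Ne.symm hx'.1]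
    have := natCast_card_filter_notMem ({0, 1, x} : Finset F)
    rw [h3] at this
    rw [← this, mul_comm, ← nsmul_eq_mul', ← Finset.sum_const, ← Finset.sum_add_distrib,
      ← Finset.sum_add_distrib]
    refine Finset.sum_congr rfl fun y hy => ?_
    have hx' := hx.2
    simp only [Finset.mem_insert, Finset.mem_singleton, not_or, Finset.mem_filter,
      Finset.mem_univ, true_and] at hx' hy
    rw [natCast_card_filter_notMem, card_forbidden hx'.1 hx'.2 hy.1 hy.2.1 hy.2.2]
    ring
  rw [hcount, Finset.sum_congr rfl hinner, Finset.sum_add_distrib, Finset.sum_add_distrib,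
    hrestrict, hrestrict, card_zero_one_neg_one, hcard2, Finset.sum_const, nsmul_eq_mul,
    natCast_card_filter_notMem, Finset.card_pair zero_ne_one]
  push_cast
  ring

end Concurrence

/-! ### Reduction to the standard frame and parametrisation of concurrent pairs. -/

section ConcurrentExtensions

variable {F : Type*} [Field F] {n : ℕ}

theorem isOffPlanes_cons_iff {w v : Fin 3 → F} {p : Fin n → Fin 3 → F} :
    IsOffPlanes (Fin.cons w p : Fin (n + 1) → Fin 3 → F) v ↔
      IsOffPlanes p v ∧ ∀ i, tri (p i) w v ≠ 0 := by
  constructor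
  · intro h
    refine ⟨fun i j hij => ?_, fun i => ?_⟩
    · exact h i.succ j.succ (by simpa)
    · exact h i.succ 0 (Fin.succ_ne_zero _)
  · rintro ⟨h1, h2⟩ i j hij
    cases i using Fin.cases with
    | zero =>
      cases j using Fin.cases with
      | zero => exact absurd rfl hij
      | succ j =>
        rw [tri_swap]
        exact neg_ne_zero.2 (h2 j)
    | succ i =>
      cases j using Fin.cases with
      | zero => exact h2 i
      | succ j => exact h1 i j fun h => hij (by rw [h])

/-- The pairs of vectors extending `p` to six vectors in general position, together with a nonzero
vector common to the three planes spanned by the first two members of `p`, by the last two members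
of `p`, and by the pair. -/
def IsConcurrentExtension (p : Fin 4 → Fin 3 → F)
    (x : (Fin 3 → F) × (Fin 3 → F) × (Fin 3 → F)) : Prop :=
  (IsOffPlanes p x.1 ∧ IsOffPlanes p x.2.1 ∧ ∀ i, tri (p i) x.1 x.2.1 ≠ 0) ∧ x.2.2 ≠ 0 ∧
    tri (p 0) (p 1) x.2.2 = 0 ∧ tri (p 2) (p 3) x.2.2 = 0 ∧ tri x.1 x.2.1 x.2.2 = 0

/-- A frame of `F ^ 3`. -/
def stdFrame (F : Type*) [Field F] : Fin 4 → Fin 3 → F :=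
  ![![1, 0, 0], ![0, 1, 0], ![0, 0, 1], ![1, 1, -1]]

/-- The linear map taking the standard basis to `a`, `b`, `c`. -/
def ofCoords (a b c r : Fin 3 → F) : Fin 3 → F := r 0 • a + r 1 • b + r 2 • c

theorem tri_ofCoords (a b c r s t : Fin 3 → F) :
    tri (ofCoords a b c r) (ofCoords a b c s) (ofCoords a b c t) = tri a b c * tri r s t := by
  simp only [tri, ofCoords, Pi.add_apply, Pi.smul_apply, smul_eq_mul]
  ring

theorem ofCoords_bijective [Finite F] {a b c : Fin 3 → F} (h : tri a b c ≠ 0) :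
    Function.Bijective (ofCoords a b c) := by
  have hs : Function.Surjective (ofCoords a b c) := fun v => by
    obtain ⟨x, y, z, rfl⟩ := exists_coords h v
    exact ⟨![x, y, z], by simp [ofCoords]⟩
  exact ⟨Finite.injective_iff_surjective.2 hs, hs⟩

theorem GenPos.exists_ofCoords {p : Fin 4 → Fin 3 → F} (hp : GenPos F p) :
    ∃ a b c : Fin 3 → F, tri a b c ≠ 0 ∧
      ∃ l : Fin 4 → F, (∀ i, l i ≠ 0) ∧ ∀ i, p i = l i • ofCoords a b c (stdFrame F i) := by
  rw [genPos_three_iff] at hp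
  have h012 := hp 0 1 2 (by decide) (by decide) (by decide)
  obtain ⟨x, y, z, h3⟩ := exists_coords h012 (p 3)
  have hx : x ≠ 0 := by
    rintro rfl
    have := hp 1 2 3 (by decide) (by decide) (by decide)
    simp [h3, tri_add_right] at this
  have hy : y ≠ 0 := by
    rintro rfl
    have := hp 0 2 3 (by decide) (by decide) (by decide)
    simp [h3, tri_add_right] at this
  have hz : z ≠ 0 := by
    rintro rfl
    have := hp 0 1 3 (by decide) (by decide) (by decide)
    simp [h3, tri_add_right] at this
  -- The coordinates of `p 3` are absorbed into the basis; the sign at `z` matches the entry `-1` of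
  -- the fourth frame vector.
  refine ⟨x • p 0, y • p 1, (-z) • p 2, ?_, ![x⁻¹, y⁻¹, (-z)⁻¹, 1], ?_, ?_⟩
  · rw [tri_smul_left, tri_smul_mid, tri_smul_right]
    exact mul_ne_zero hx (mul_ne_zero hy (mul_ne_zero (neg_ne_zero.2 hz) h012))
  · intro i
    fin_cases i <;> simp [hx, hy, hz]
  · intro i
    fin_cases i
    · simp [ofCoords, stdFrame, smul_smul, hx]
    · simp [ofCoords, stdFrame, smul_smul, hy]
    · simp [ofCoords, stdFrame, smul_smul, hz]
    · simp [ofCoords, stdFrame, h3]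

theorem ofCoords_eq_zero_iff [Finite F] {a b c : Fin 3 → F} (h : tri a b c ≠ 0) (r : Fin 3 → F) :
    ofCoords a b c r = 0 ↔ r = 0 := by
  constructor
  · intro hr
    exact (ofCoords_bijective h).1 (hr.trans (by simp [ofCoords]))
  · rintro rfl
    simp [ofCoords]

/-- Up to nonzero scalars on its members, `p` is the image of the standard frame under an invertible
linear map. The conditions ignore such scalars, and the map multiplies every determinant by the same
nonzero constant. -/
theorem GenPos.card_isConcurrentExtension [Finite F] {p : Fin 4 → Fin 3 → F} (hp : GenPos F p) :
    Nat.card {x // IsConcurrentExtension p x} =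
      Nat.card {x // IsConcurrentExtension (stdFrame F) x} := by
  obtain ⟨a, b, c, hD, l, hl, hpl⟩ := hp.exists_ofCoords
  let e : (Fin 3 → F) ≃ (Fin 3 → F) := Equiv.ofBijective _ (ofCoords_bijective hD)
  refine (Nat.card_congr (Equiv.subtypeEquiv (e.prodCongr (e.prodCongr e)) ?_)).symm
  rintro ⟨r, s, t⟩
  have hoff : ∀ r, IsOffPlanes p (e r) ↔ IsOffPlanes (stdFrame F) r := fun r => by
    simp only [IsOffPlanes, hpl, e, Equiv.ofBijective_apply, tri_smul_left, tri_smul_mid,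
      tri_ofCoords, mul_ne_zero_iff, hl, hD, ne_eq, not_false_eq_true, true_and]
  simp only [IsConcurrentExtension, Equiv.prodCongr_apply, Prod.map_apply, hoff]
  simp only [hpl, e, Equiv.ofBijective_apply, tri_smul_left, tri_smul_mid,
      tri_ofCoords, hl, hD, ne_eq, mul_eq_zero, false_or, ofCoords_eq_zero_iff hD]

theorem isOffPlanes_iff_lt {p : Fin n → Fin 3 → F} {v : Fin 3 → F} :
    IsOffPlanes p v ↔ ∀ i j, i < j → tri (p i) (p j) v ≠ 0 := by
  refine ⟨fun h i j hij => h i j hij.ne, fun h i j hij => ?_⟩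
  rcases lt_or_gt_of_ne hij with hlt | hlt
  · exact h i j hlt
  · rw [tri_swap]
    exact neg_ne_zero.2 (h j i hlt)

theorem isOffPlanes_stdFrame_iff (v : Fin 3 → F) :
    IsOffPlanes (stdFrame F) v ↔
      (v 0 ≠ 0 ∧ v 1 ≠ 0 ∧ v 2 ≠ 0) ∧ v 1 ≠ v 0 ∧ v 0 + v 2 ≠ 0 ∧ v 1 + v 2 ≠ 0 := by
  have h : IsOffPlanes (stdFrame F) v ↔
      tri (stdFrame F 0) (stdFrame F 1) v ≠ 0 ∧ tri (stdFrame F 0) (stdFrame F 2) v ≠ 0 ∧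
      tri (stdFrame F 0) (stdFrame F 3) v ≠ 0 ∧ tri (stdFrame F 1) (stdFrame F 2) v ≠ 0 ∧
      tri (stdFrame F 1) (stdFrame F 3) v ≠ 0 ∧ tri (stdFrame F 2) (stdFrame F 3) v ≠ 0 := by
    rw [isOffPlanes_iff_lt]
    constructor
    · intro h
      exact ⟨h 0 1 (by decide), h 0 2 (by decide), h 0 3 (by decide), h 1 2 (by decide),
        h 1 3 (by decide), h 2 3 (by decide)⟩
    · rintro ⟨h1, h2, h3, h4, h5, h6⟩ i j hij
      fin_cases i <;> fin_cases j <;> first | exact absurd hij (by decide) | assumption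
  have e1 : tri (stdFrame F 0) (stdFrame F 1) v = v 2 := by simp [tri, stdFrame]
  have e2 : tri (stdFrame F 0) (stdFrame F 2) v = -v 1 := by simp [tri, stdFrame]
  have e3 : tri (stdFrame F 0) (stdFrame F 3) v = v 1 + v 2 := by simp [tri, stdFrame]; ring
  have e4 : tri (stdFrame F 1) (stdFrame F 2) v = v 0 := by simp [tri, stdFrame]
  have e5 : tri (stdFrame F 1) (stdFrame F 3) v = -(v 0 + v 2) := by simp [tri, stdFrame]; ring
  have e6 : tri (stdFrame F 2) (stdFrame F 3) v = v 1 - v 0 := by simp [tri, stdFrame]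
  rw [h, e1, e2, e3, e4, e5, e6, neg_ne_zero, neg_ne_zero, sub_ne_zero]
  tauto

/-- The planes of the first two and of the last two frame vectors meet in the line of `(1, 1, 0)`.
Concurrence says that this vector lies in the span of `w` and `w'`, so suitable multiples `(x, y,
z)` of `w` and `(x - 1, y - 1, z)` of `w'` differ by it. The conditions on the parameters are then
general position. -/
theorem isConcurrentExtension_stdFrame_iff (w w' v : Fin 3 → F) :
    IsConcurrentExtension (stdFrame F) (w, w', v) ↔
      ∃ u t s x y z : F, u ≠ 0 ∧ t ≠ 0 ∧ s ≠ 0 ∧ IsConcurrenceParam x y z ∧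
        w = ![u * x, u * y, u * z] ∧ w' = ![t * (x - 1), t * (y - 1), t * z] ∧ v = ![s, s, 0] := by
  have e1 : ∀ v : Fin 3 → F, tri (stdFrame F 0) (stdFrame F 1) v = v 2 := by simp [tri, stdFrame]
  have e6 : ∀ v : Fin 3 → F, tri (stdFrame F 2) (stdFrame F 3) v = v 1 - v 0 := by
    simp [tri, stdFrame]
  simp only [IsConcurrentExtension, isOffPlanes_stdFrame_iff, e1, e6]
  constructor
  · rintro ⟨⟨⟨⟨hw0, hw1, hw2⟩, hw10, hw02, hw12⟩, ⟨⟨hw0', hw1', hw2'⟩, hw10', hw02', hw12'⟩, hi⟩,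
      hv, hv2, hv10, h0⟩
    -- Up to sign this is the determinant of the second frame vector, `w` and `w'`.
    have hT : w 0 * w' 2 - w 2 * w' 0 ≠ 0 := fun h => hi 1 (by
      simp only [tri, stdFrame, Matrix.cons_val]
      linear_combination -h)
    have hs : v 0 ≠ 0 := fun h => hv (by
      rw [h, sub_zero] at hv10
      funext i
      fin_cases i <;> simp [h, hv2, hv10])
    -- After cancelling `v 0`, this equality is the concurrence condition `h0` for `v = (v 0, v 0,
    -- 0)`.
    have hR : w 1 * w' 2 - w 2 * w' 1 = w 0 * w' 2 - w 2 * w' 0 := by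
      refine mul_left_cancel₀ hs ?_
      simp only [tri, hv2, sub_eq_zero.1 hv10] at h0
      linear_combination h0
    set T := w 0 * w' 2 - w 2 * w' 0 with hTdef
    -- The combination `w' 2 • w - w 2 • w'` equals `T • (1, 1, 0)`; dividing by `T` gives the two
    -- multiples and hence the scalars `u` and `t`.
    refine ⟨T / w' 2, T / w 2, v 0, w 0 * w' 2 / T, w 1 * w' 2 / T, w 2 * w' 2 / T,
      div_ne_zero hT hw2', div_ne_zero hT hw2, hs,
      ⟨⟨div_ne_zero (mul_ne_zero hw0 hw2') hT, ?_⟩,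
        ⟨div_ne_zero (mul_ne_zero hw1 hw2') hT, ?_, ?_⟩,
        div_ne_zero (mul_ne_zero hw2 hw2') hT, ?_, ?_, ?_, ?_⟩, ?_, ?_, ?_⟩
    · rw [ne_eq, div_eq_one_iff_eq hT]
      exact fun h => mul_ne_zero hw2 hw0' (by linear_combination h + hTdef)
    · rw [ne_eq, div_eq_one_iff_eq hT]
      exact fun h => mul_ne_zero hw2 hw1' (by linear_combination h - hR)
    · rw [ne_eq, div_left_inj' hT]
      exact fun h => hw10 (mul_right_cancel₀ hw2' h)
    · rw [ne_eq, ← neg_div, div_left_inj' hT]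
      exact fun h => mul_ne_zero hw02 hw2' (by linear_combination h)
    · rw [ne_eq, one_sub_div hT, div_left_inj' hT]
      exact fun h => mul_ne_zero hw2 hw02' (by linear_combination h + hTdef)
    · rw [ne_eq, ← neg_div, div_left_inj' hT]
      exact fun h => mul_ne_zero hw12 hw2' (by linear_combination h)
    · rw [ne_eq, one_sub_div hT, div_left_inj' hT]
      exact fun h => mul_ne_zero hw2 hw12' (by linear_combination h - hR)
    · funext i
      fin_cases i <;> simp <;> field_simp
    · funext i
      fin_cases i
      · simp only [Fin.zero_eta, Matrix.cons_val_zero]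
        field_simp
        linear_combination hTdef
      · simp only [Fin.mk_one, Matrix.cons_val_one, Matrix.cons_val_zero]
        field_simp
        linear_combination -hR
      · simp only [Fin.reduceFinMk, Matrix.cons_val]
        field_simp
    · funext i
      fin_cases i
      · rfl
      · exact sub_eq_zero.1 hv10
      · exact hv2
  · rintro ⟨u, t, s, x, y, z, hu, ht, hs, ⟨⟨hx0, hx1⟩, ⟨hy0, hy1, hyx⟩, hz0, hzx, hzx1, hzy, hzy1⟩,
      rfl, rfl, rfl⟩
    simp only [Matrix.cons_val]
    refine ⟨⟨⟨⟨mul_ne_zero hu hx0, mul_ne_zero hu hy0, mul_ne_zero hu hz0⟩, ?_, ?_, ?_⟩,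
      ⟨⟨mul_ne_zero ht (sub_ne_zero.2 hx1), mul_ne_zero ht (sub_ne_zero.2 hy1),
        mul_ne_zero ht hz0⟩, ?_, ?_, ?_⟩, ?_⟩, ?_, trivial, sub_self s, ?_⟩
    · exact fun h => hyx (mul_left_cancel₀ hu h)
    · rw [← mul_add]
      exact mul_ne_zero hu fun h => hzx (by linear_combination h)
    · rw [← mul_add]
      exact mul_ne_zero hu fun h => hzy (by linear_combination h)
    · exact fun h => hyx (by linear_combination mul_left_cancel₀ ht h)
    · rw [← mul_add]
      exact mul_ne_zero ht fun h => hzx1 (by linear_combination h)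
    · rw [← mul_add]
      exact mul_ne_zero ht fun h => hzy1 (by linear_combination h)
    · have hutz := mul_ne_zero (mul_ne_zero hu ht) hz0
      have huty := mul_ne_zero (mul_ne_zero hu ht) (sub_ne_zero.2 hyx)
      intro i h
      fin_cases i <;> simp [tri, stdFrame] at h
      · exact hutz (by linear_combination h)
      · exact hutz (by linear_combination -h)
      · exact huty (by linear_combination h)
      · exact huty (by linear_combination -h)
    · exact fun h => hs (congrFun h 0)
    · simp [tri]
      ring

/-- The scalars `u`, `t`, `s` and the parameters are determined by the configuration, so the scalars
contribute exactly `(q - 1) ^ 3`. -/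
theorem card_isConcurrentExtension_stdFrame [Fintype F] :
    (Nat.card {x // IsConcurrentExtension (stdFrame F) x} : ℤ) =
      ((Fintype.card F : ℤ) - 1) ^ 3 *
        (((Fintype.card F : ℤ) - 3) ^ 2 * ((Fintype.card F : ℤ) - 4) +
        2 * evenIndicator (Fintype.card F)) := by
  have hq : 1 ≤ Fintype.card F := Fintype.card_pos
  have hu : ((Fintype.card F : ℤ) - 1) = Nat.card Fˣ := by
    rw [Nat.card_units, Nat.card_eq_fintype_card]
    push_cast [hq]
    rfl
  rw [← card_isConcurrenceParam, hu, ← Nat.cast_pow, ← Nat.cast_mul]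
  have hprod : Nat.card Fˣ ^ 3 * Nat.card {t : F × F × F // IsConcurrenceParam t.1 t.2.1 t.2.2} =
      Nat.card ((Fˣ × Fˣ × Fˣ) × {t : F × F × F // IsConcurrenceParam t.1 t.2.1 t.2.2}) := by
    simp only [Nat.card_prod]
    ring
  rw [hprod, Nat.cast_inj]
  refine (Nat.card_eq_of_bijective (fun a :
    (Fˣ × Fˣ × Fˣ) × {t : F × F × F // IsConcurrenceParam t.1 t.2.1 t.2.2} =>
    (⟨(_, _, _), (isConcurrentExtension_stdFrame_iff _ _ _).2
      ⟨a.1.1, a.1.2.1, a.1.2.2, a.2.1.1, a.2.1.2.1, a.2.1.2.2, a.1.1.ne_zero, a.1.2.1.ne_zero,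
        a.1.2.2.ne_zero, a.2.2, rfl, rfl, rfl⟩⟩ :
      {x // IsConcurrentExtension (stdFrame F) x})) ⟨?_, ?_⟩).symm
  · rintro ⟨⟨u, t, s⟩, ⟨x, y, z⟩, h⟩ ⟨⟨u', t', s'⟩, ⟨x', y', z'⟩, h'⟩ he
    have he := congrArg Subtype.val he
    simp only [Prod.mk.injEq] at he
    obtain ⟨h1, h2, h3⟩ := he
    have hs : s = s' := Units.ext (congrFun h3 0)
    have hX : (u : F) * x = u' * x' := congrFun h1 0
    have hY : (u : F) * y = u' * y' := congrFun h1 1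
    have hZ : (u : F) * z = u' * z' := congrFun h1 2
    have hX' : (t : F) * (x - 1) = t' * (x' - 1) := congrFun h2 0
    have hZ' : (t : F) * z = t' * z' := congrFun h2 2
    have hz : z ≠ 0 := h.2.2.1
    -- The third coordinates fix the ratio of the scalars; the first coordinates, which involve `x`
    -- and `x - 1`, then fix the scalars themselves.
    have hut : (t : F) * u' = t' * u := by
      have hz' : z' ≠ 0 := h'.2.2.1
      refine mul_right_cancel₀ (mul_ne_zero hz hz') ?_
      linear_combination (u' * z') * hZ' - (t' * z') * hZ
    have htt : (t : F) = t' := by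
      refine mul_right_cancel₀ u.ne_zero ?_
      linear_combination t * hX - u * hX' + x' * hut
    have huu : (u : F) = u' := by
      rw [htt] at hut
      exact (mul_left_cancel₀ t'.ne_zero hut).symm
    rw [huu] at hX hY hZ
    obtain rfl := mul_left_cancel₀ u'.ne_zero hX
    obtain rfl := mul_left_cancel₀ u'.ne_zero hY
    obtain rfl := mul_left_cancel₀ u'.ne_zero hZ
    rw [Units.ext htt, Units.ext huu, hs]
  · rintro ⟨⟨w, w', v⟩, h⟩
    obtain ⟨u, t, s, x, y, z, hu, ht, hs, hp, rfl, rfl, rfl⟩ :=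
      (isConcurrentExtension_stdFrame_iff _ _ _).1 h
    exact ⟨⟨⟨Units.mk0 u hu, Units.mk0 t ht, Units.mk0 s hs⟩, ⟨⟨x, y, z⟩, hp⟩⟩, rfl⟩

end ConcurrentExtensions

/-! ### The triple term for six vectors, and tuples of seven vectors. -/

section SevenArcs

variable {F : Type*} [Field F] {n : ℕ}

/-- Every `p m` lies outside at least one of the two planes, because their index pairs are disjoint.
-/
theorem GenPos.isOffPoints_of_two_planes {p : Fin n → Fin 3 → F} (hp : GenPos F p)
    {i j k l : Fin n} (hij : i ≠ j) (hkl : k ≠ l) (hik : i ≠ k) (hil : i ≠ l)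
    (hjk : j ≠ k) (hjl : j ≠ l) {v : Fin 3 → F} (hv : v ≠ 0) (h1 : tri (p i) (p j) v = 0)
    (h2 : tri (p k) (p l) v = 0) : IsOffPoints p v := by
  rintro m c rfl
  have hc : c ≠ 0 := fun h => hv (by rw [h, zero_smul])
  rw [genPos_three_iff] at hp
  simp only [tri_smul_right, mul_eq_zero, hc, false_or] at h1 h2
  by_cases hmi : m = i
  · subst hmi
    exact hp k l m hkl hik.symm hil.symm h2
  by_cases hmj : m = j
  · subst hmj
    exact hp k l m hkl hjk.symm hjl.symm h2
  exact hp i j m hij (Ne.symm hmi) (Ne.symm hmj) h1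

/-- Six vectors in general position with a vector, off these six, that is common to the three
planes spanned by the pairs which `f` names. -/
def IsConcurrentSextuple (f : Fin 6 → Fin 6)
    (y : (Fin 6 → Fin 3 → F) × (Fin 3 → F)) : Prop :=
  GenPos F y.1 ∧ IsOffPoints y.1 y.2 ∧ tri (y.1 (f 0)) (y.1 (f 1)) y.2 = 0 ∧
    tri (y.1 (f 2)) (y.1 (f 3)) y.2 = 0 ∧ tri (y.1 (f 4)) (y.1 (f 5)) y.2 = 0

/-- In the extended tuple, positions `0` and `1` hold `w'` and `w`, and positions `2` to `5` hold
`p`, so the pairs named by `id` are exactly those of a concurrent extension. -/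
theorem isConcurrentSextuple_cons_iff (p : Fin 4 → Fin 3 → F) (w w' v : Fin 3 → F) :
    IsConcurrentSextuple id ((Fin.cons w' (Fin.cons w p : Fin 5 → Fin 3 → F), v)) ↔
      GenPos F p ∧ IsConcurrentExtension p (w, w', v) := by
  have hgen : GenPos F (Fin.cons w' (Fin.cons w p : Fin 5 → Fin 3 → F) : Fin 6 → Fin 3 → F) ↔
      GenPos F p ∧ IsOffPlanes p w ∧ IsOffPlanes p w' ∧ ∀ i, tri (p i) w w' ≠ 0 := by
    rw [genPos_three_cons, genPos_three_cons, isOffPlanes_cons_iff, and_assoc]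
  have h0 : tri w' w v = 0 ↔ tri w w' v = 0 := by rw [tri_swap, neg_eq_zero]
  constructor
  · rintro ⟨h1, h2, h3, h4, h5⟩
    refine ⟨(hgen.1 h1).1, (hgen.1 h1).2, ?_, h4, h5, h0.1 h3⟩
    rintro rfl
    exact h2 0 0 (by simp)
  · rintro ⟨hp, h1, hv, h2, h3, h4⟩
    refine ⟨hgen.2 ⟨hp, h1⟩, ?_, h0.2 h4, h2, h3⟩
    exact (hgen.2 ⟨hp, h1⟩).isOffPoints_of_two_planes (i := 2) (j := 3) (k := 4) (l := 5)
      (by decide) (by decide) (by decide) (by decide) (by decide) (by decide) hv h2 h3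

theorem card_isConcurrentSextuple_id [Finite F] :
    Nat.card {y // IsConcurrentSextuple (F := F) id y} =
      Nat.card {p : Fin 4 → Fin 3 → F // GenPos F p} *
        Nat.card {x // IsConcurrentExtension (stdFrame F) x} := by
  classical
  have := Fintype.ofFinite {p : Fin 4 → Fin 3 → F // GenPos F p}
  have hsum : Nat.card (Σ p : {p : Fin 4 → Fin 3 → F // GenPos F p},
      {x // IsConcurrentExtension p.1 x}) = Nat.card {p : Fin 4 → Fin 3 → F // GenPos F p} *
        Nat.card {x // IsConcurrentExtension (stdFrame F) x} := by
    rw [Nat.card_sigma, Finset.sum_congr rfl fun p _ => p.2.card_isConcurrentExtension]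
    simp
  rw [← hsum]
  refine (Nat.card_eq_of_bijective (fun a : (Σ p : {p : Fin 4 → Fin 3 → F // GenPos F p},
      {x // IsConcurrentExtension p.1 x}) =>
    (⟨(Fin.cons a.2.1.2.1 (Fin.cons a.2.1.1 a.1.1 : Fin 5 → Fin 3 → F), a.2.1.2.2),
      (isConcurrentSextuple_cons_iff _ _ _ _).2 ⟨a.1.2, a.2.2⟩⟩ :
      {y // IsConcurrentSextuple (F := F) id y})) ⟨?_, ?_⟩).symm
  · rintro ⟨⟨p, hp⟩, ⟨w, w', v⟩, hx⟩ ⟨⟨p₁, hp₁⟩, ⟨w₁, w₁', v₁⟩, hx₁⟩ h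
    have h1 := congrArg Subtype.val h
    simp only [Prod.mk.injEq] at h1
    obtain ⟨h2, rfl⟩ := h1
    obtain ⟨rfl, h3⟩ := Fin.cons_inj.1 h2
    obtain ⟨rfl, rfl⟩ := Fin.cons_inj.1 h3
    rfl
  · rintro ⟨⟨x, v⟩, hx⟩
    obtain ⟨w', x, rfl⟩ : ∃ w' y, x = (Fin.cons w' y : Fin 6 → Fin 3 → F) :=
      ⟨x 0, Fin.tail x, (Fin.cons_self_tail x).symm⟩
    obtain ⟨w, p, rfl⟩ : ∃ w p, x = (Fin.cons w p : Fin 5 → Fin 3 → F) :=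
      ⟨x 0, Fin.tail x, (Fin.cons_self_tail x).symm⟩
    have h := (isConcurrentSextuple_cons_iff p w w' v).1 hx
    exact ⟨⟨⟨p, h.1⟩, ⟨(w, w', v), h.2⟩⟩, rfl⟩

/-- An injective `f` is a permutation; reindexing the six vectors by it preserves general position
and turns the pairs named by `f` into those named by `id`. -/
theorem card_isConcurrentSextuple [Finite F] {f : Fin 6 → Fin 6} (hf : f.Injective) :
    Nat.card {y // IsConcurrentSextuple (F := F) f y} =
      Nat.card {y // IsConcurrentSextuple (F := F) id y} := by
  let e : Fin 6 ≃ Fin 6 := Equiv.ofBijective f (Finite.injective_iff_bijective.1 hf)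
  refine Nat.card_congr (Equiv.subtypeEquiv
    ((e.symm.arrowCongr (Equiv.refl (Fin 3 → F))).prodCongr (Equiv.refl (Fin 3 → F))) ?_)
  rintro ⟨p, v⟩
  have hgen : GenPos F (p ∘ f) ↔ GenPos F p := by
    refine ⟨fun h => ?_, fun h => h.comp hf⟩
    have := h.comp e.symm.injective
    convert this using 1
    funext i
    exact congrArg p (e.apply_symm_apply i).symm
  have hoff : IsOffPoints (p ∘ f) v ↔ IsOffPoints p v := by
    refine ⟨fun h i c => ?_, fun h i c => h (f i) c⟩
    obtain ⟨j, rfl⟩ := e.surjective i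
    exact h j c
  change _ ↔ IsConcurrentSextuple id (p ∘ f, v)
  simp only [IsConcurrentSextuple, hgen, hoff]
  rfl

theorem exists_injective_of_mem_matchings {τ : Finset (Fin 6 × Fin 6)} (hτ : τ ∈ matchings 6 3) :
    ∃ f : Fin 6 → Fin 6, f.Injective ∧ τ = {(f 0, f 1), (f 2, f 3), (f 4, f 5)} := by
  obtain ⟨⟨hsub, h3⟩, hd⟩ := mem_matchings.1 hτ
  obtain ⟨s, t, u, hst, hsu, htu, rfl⟩ := Finset.card_eq_three.1 h3
  obtain ⟨a1, a2, a3, a4⟩ := hd s (by simp) t (by simp) hst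
  obtain ⟨b1, b2, b3, b4⟩ := hd s (by simp) u (by simp) hsu
  obtain ⟨c1, c2, c3, c4⟩ := hd t (by simp) u (by simp) htu
  have hs := hsub (show s ∈ {s, t, u} by simp)
  have ht := hsub (show t ∈ {s, t, u} by simp)
  have hu := hsub (show u ∈ {s, t, u} by simp)
  simp only [indexPairs, Finset.mem_filter] at hs ht hu
  refine ⟨![s.1, s.2, t.1, t.2, u.1, u.2], ?_, rfl⟩
  have hinj : ∀ i j : Fin 6, i < j → ![s.1, s.2, t.1, t.2, u.1, u.2] i ≠
      ![s.1, s.2, t.1, t.2, u.1, u.2] j := by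
    have d1 := hs.2.ne
    have d2 := ht.2.ne
    have d3 := hu.2.ne
    intro i j hij
    fin_cases i <;> fin_cases j <;> first | exact absurd hij (by decide) | assumption
  intro i j h
  by_contra hij
  rcases lt_or_gt_of_ne hij with hlt | hlt
  · exact hinj i j hlt h
  · exact hinj j i hlt h.symm

/-- The number of extensions now depends on the sextuple, so the triple term is summed over all
sextuples before the matchings are separated. Each of the 15 perfect matchings gives the same total.
-/
theorem card_genPos_seven_three [Fintype F] :
    (Nat.card {p : Fin 7 → Fin 3 → F // GenPos F p} : ℤ) =
      Nat.card {p : Fin 6 → Fin 3 → F // GenPos F p} *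
        ((Fintype.card F : ℤ) ^ 3 - 1 - 6 * ((Fintype.card F : ℤ) - 1)
          - 15 * ((Fintype.card F : ℤ) - 1) ^ 2 + 45 * ((Fintype.card F : ℤ) - 1)) -
      15 * (Nat.card {p : Fin 4 → Fin 3 → F // GenPos F p} *
        Nat.card {x // IsConcurrentExtension (stdFrame F) x}) := by
  classical
  obtain ⟨-, -, -, c1, -, -, -, c2, c3⟩ := card_indexPairs_matchings
  have hτ : ∀ τ ∈ matchings 6 3, ∑ p : {p : Fin 6 → Fin 3 → F // GenPos F p},
      (Nat.card {v // IsOffPoints p.1 v ∧ ∀ s ∈ τ, tri (p.1 s.1) (p.1 s.2) v = 0} : ℤ) =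
      Nat.card {p : Fin 4 → Fin 3 → F // GenPos F p} *
        Nat.card {x // IsConcurrentExtension (stdFrame F) x} := by
    intro τ h
    obtain ⟨f, hf, rfl⟩ := exists_injective_of_mem_matchings h
    rw [← Nat.cast_mul, ← card_isConcurrentSextuple_id, ← card_isConcurrentSextuple hf,
      ← Nat.cast_sum, ← Nat.card_sigma, Nat.cast_inj]
    refine Nat.card_congr
      { toFun := fun a => ⟨(a.1.1, a.2.1), ?_⟩
        invFun := fun y => ⟨⟨y.1.1, y.2.1⟩, ⟨y.1.2, y.2.2.1, ?_⟩⟩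
        left_inv := fun _ => rfl
        right_inv := fun _ => rfl }
    · exact ⟨a.1.2, a.2.2.1, a.2.2.2 (f 0, f 1) (by simp), a.2.2.2 (f 2, f 3) (by simp),
        a.2.2.2 (f 4, f 5) (by simp)⟩
    · simpa using y.2.2.2
  rw [card_cons_eq_sum _ _ _ genPos_three_cons, Nat.cast_sum,
    Finset.sum_congr rfl fun p _ => p.2.card_isOffPlanes (by norm_num) (by norm_num),
    Finset.sum_sub_distrib, Finset.sum_comm, Finset.sum_congr rfl hτ, c1, c2]
  simp [c3]

end SevenArcs

/-! ### Assembling the four formulas. -/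

theorem theorem1p7 {F : Type*} [Field F] [Finite F] (q : ℕ) (hq : Nat.card F = q) :
    (numOrderedArcs F 4 4 : ℤ) =
      ((q : ℤ) ^ 2 + q + 1) * ((q : ℤ) ^ 2 + 1) * ((q : ℤ) + 1) ^ 2 * (q : ℤ) ^ 6 ∧
    (numOrderedArcs F 5 4 : ℤ) =
      ((q : ℤ) ^ 2 + q + 1) * ((q : ℤ) ^ 2 + 1) * ((q : ℤ) + 1) ^ 2 * ((q : ℤ) - 1) ^ 3 *
        (q : ℤ) ^ 6 ∧
    (numOrderedArcs F 6 4 : ℤ) =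
      ((q : ℤ) ^ 2 + q + 1) * ((q : ℤ) ^ 2 + 1) * ((q : ℤ) + 1) ^ 2 * ((q : ℤ) - 1) ^ 3 *
        ((q : ℤ) - 2) * ((q : ℤ) - 3) * ((q : ℤ) - 4) * (q : ℤ) ^ 6 ∧
    (numOrderedArcs F 7 4 : ℤ) =
      ((q : ℤ) ^ 2 + q + 1) * ((q : ℤ) ^ 2 + 1) * ((q : ℤ) + 1) ^ 2 * ((q : ℤ) - 1) ^ 3 *
        (q : ℤ) ^ 6 *
        ((q : ℤ) ^ 6 - 28 * (q : ℤ) ^ 5 + 323 * (q : ℤ) ^ 4 - 1952 * (q : ℤ) ^ 3 +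
          6462 * (q : ℤ) ^ 2 - 11004 * (q : ℤ) + 7470 - 30 * evenIndicator q) := by
  have := Fintype.ofFinite F
  have hqc : Fintype.card F = q := by rw [← hq, Nat.card_eq_fintype_card]
  have hq1 : 1 < q := by rw [← hqc]; exact Fintype.one_lt_card
  have hpow : ∀ {i j : ℕ}, i ≤ j → q ^ i ≤ q ^ j := fun h => Nat.pow_le_pow_right hq1.le h
  have hq0 : (q : ℤ) - 1 ≠ 0 := by
    have : (1 : ℤ) < q := by exact_mod_cast hq1
    omega
  have arcs : ∀ m, 4 ≤ m → (numOrderedArcs F m 4 : ℤ) * ((q : ℤ) - 1) ^ m =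
      Nat.card {p : Fin m → Fin 4 → F // GenPos F p} := by
    intro m hm
    have := numOrderedArcs_mul (F := F) (n := m) (k := 4) (by norm_num) hm
    rw [hq] at this
    have h := congrArg (Nat.cast : ℕ → ℤ) this
    rw [Nat.cast_mul, Nat.cast_pow, Nat.cast_sub hq1.le] at h
    exact_mod_cast h
  have frame : ∀ k : ℕ, ((∏ i : Fin k, (q ^ k - q ^ (i : ℕ)) : ℕ) : ℤ) =
      ∏ i : Fin k, ((q : ℤ) ^ k - (q : ℤ) ^ (i : ℕ)) := fun k => by
    rw [Nat.cast_prod]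
    refine Finset.prod_congr rfl fun i _ => ?_
    rw [Nat.cast_sub (hpow i.2.le)]
    push_cast
    rfl
  have framene : ∀ k : ℕ, ∏ i : Fin k, ((q : ℤ) ^ k - (q : ℤ) ^ (i : ℕ)) ≠ 0 := fun k => by
    refine Finset.prod_ne_zero_iff.2 fun i _ => sub_ne_zero.2 fun h => ?_
    have : q ^ k = q ^ (i : ℕ) := by exact_mod_cast h
    exact i.2.ne' (Nat.pow_right_injective hq1 this)
  -- `N` is the number of tuples in `F ^ l` divided by the order of the general linear group of `F ^
  -- l`; duality replaces that order by the one for `F ^ 4`.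
  have dual : ∀ l N, (Nat.card {p : Fin (4 + l) → Fin l → F // GenPos F p} : ℤ) =
        (∏ i : Fin l, ((q : ℤ) ^ l - (q : ℤ) ^ (i : ℕ))) * N →
      (numOrderedArcs F (4 + l) 4 : ℤ) * ((q : ℤ) - 1) ^ (4 + l) =
        (((q : ℤ) ^ 4 - 1) * ((q : ℤ) ^ 4 - q) * ((q : ℤ) ^ 4 - (q : ℤ) ^ 2) *
          ((q : ℤ) ^ 4 - (q : ℤ) ^ 3)) * N := by
    intro l N h
    rw [arcs _ (by omega)]
    have hd := congrArg (Nat.cast : ℕ → ℤ) (card_genPos_dual (F := F) (rfl : 4 + l = 4 + l))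
    rw [hq, Nat.cast_mul, Nat.cast_mul, h, frame, frame, Fin.prod_univ_four] at hd
    refine mul_right_cancel₀ (framene l) ?_
    rw [hd]
    simp only [Fin.val_zero, Fin.val_one, Fin.val_two, pow_zero, pow_one]
    norm_num
    ring
  obtain ⟨a3, a4, a5, -, m3, m4, m5, -, -⟩ := card_indexPairs_matchings
  refine ⟨?_, ?_, ?_, ?_⟩
  · have h := dual 0 1 (by rw [card_genPos_zero]; simp)
    refine mul_right_cancel₀ (pow_ne_zero 4 hq0) ?_
    rw [Nat.add_zero] at h
    linear_combination h
  · have h := dual 1 (((q : ℤ) - 1) ^ 4) (by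
      rw [card_genPos_one, hq, Nat.cast_pow, Nat.cast_sub hq1.le]
      simp
      ring)
    refine mul_right_cancel₀ (pow_ne_zero 5 hq0) ?_
    linear_combination h
  · have c2 : (Nat.card {p : Fin 2 → Fin 2 → F // GenPos F p} : ℤ) =
        ∏ i : Fin 2, ((q : ℤ) ^ 2 - (q : ℤ) ^ (i : ℕ)) := by
      rw [card_genPos_self, hq, frame]
    have c3 := card_genPos_two_succ (F := F) (n := 2) le_rfl
    have c4 := card_genPos_two_succ (F := F) (n := 3) (by norm_num)
    have c5 := card_genPos_two_succ (F := F) (n := 4) (by norm_num)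
    have c6 := card_genPos_two_succ (F := F) (n := 5) (by norm_num)
    rw [hqc] at c3 c4 c5 c6
    rw [c5, c4, c3, c2] at c6
    have h := dual 2 _ (by rw [c6, mul_assoc, mul_assoc, mul_assoc])
    refine mul_right_cancel₀ (pow_ne_zero 6 hq0) ?_
    push_cast at h
    linear_combination h
  · have c3 : (Nat.card {p : Fin 3 → Fin 3 → F // GenPos F p} : ℤ) =
        ∏ i : Fin 3, ((q : ℤ) ^ 3 - (q : ℤ) ^ (i : ℕ)) := by
      rw [card_genPos_self, hq, frame]
    have c4 := card_genPos_three_succ (F := F) (n := 3) le_rfl (by norm_num)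
    have c5 := card_genPos_three_succ (F := F) (n := 4) (by norm_num) (by norm_num)
    have c6 := card_genPos_three_succ (F := F) (n := 5) (by norm_num) (by norm_num)
    have c7 := card_genPos_seven_three (F := F)
    rw [card_isConcurrentExtension_stdFrame] at c7
    rw [hqc] at c4 c5 c6 c7
    rw [a3, m3, c3] at c4
    rw [a4, m4, c4] at c5
    rw [a5, m5, c5] at c6
    -- Both the main term and the triple term contain the count of bases of `F ^ 3`; it is pulled
    -- out in front to reach the shape that `dual` needs.
    rw [c6, c4, mul_assoc, mul_assoc, mul_assoc, mul_assoc, mul_left_comm (15 : ℤ), ← mul_sub] at c7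
    have h := dual 3 _ c7
    refine mul_right_cancel₀ (pow_ne_zero 7 hq0) ?_
    push_cast at h
    linear_combination h
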